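/- Let $\mathcal A$ be a unital $C^*$-algebra and let $\pi:\mathcal A\to\mathbf L(\mathcal H)$ be a faithful atomic representation, i.e. a faithful representation that is (unitarily equivalent to) a Hilbert direct sum of pairwise inequivalent irreducible representations. Write $\mathcal A\check\otimes\mathcal A$ for the spatial $C^*$-tensor product, regarded via $\pi\otimes\pi$ as an algebra of operators on the Hilbert space tensor product $\mathcal H\bar\otimes\mathcal H$. Let $P_\delta$ be the supremum of all projections $p\otimes p$ on $\mathcal H\bar\otimes\mathcal H$ with $p$ a minimal projection of the von Neumann algebra $\pi(\mathcal A)''$, and let $\mathcal H_\delta$ be its image. The triple $(\mathcal A,\rho,\pi)$ is called a compact quantum metric space if $\rho\in\mathcal A\check\otimes\mathcal A$ satisfies: (i) $\rho\ge 0$; (ii) $\rho P_\delta=P_\delta\rho=0$; (iii) $0$ is not an eigenvalue of the restriction of $\rho$ to $\mathcal H_\delta^\perp$; (iv) $\mathfrak F(\rho)=\rho$, where $\mathfrak F(a\otimes b)=b\otimes a$ is the flip; (v) $\mathfrak M(\rho)\le\rho\otimes 1+1\otimes\rho$ in $\mathcal A\check\otimes\mathcal A\check\otimes\mathcal A$,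 where $\mathfrak M$ is the $*$-morphism with $\mathfrak M(a\otimes b)=a\otimes 1\otimes b$. **Theorem 4.** Let $(\mathcal A_1,\rho_1,\pi_1)$ and $(\mathcal A_2,\rho_2,\pi_2)$ be compact quantum metric spaces. Then $(\mathcal A_1\check\otimes\mathcal A_2,\rho,\pi_1\otimes\pi_2)$ is a compact quantum metric space, where $$\rho=\rho_1\otimes 1_{\mathcal A_2\check\otimes\mathcal A_2}+1_{\mathcal A_1\check\otimes\mathcal A_1}\otimes\rho_2\in(\mathcal A_1\check\otimes\mathcal A_1)\check\otimes(\mathcal A_2\check\otimes\mathcal A_2)\cong(\mathcal A_1\check\otimes\mathcal A_2)\check\otimes(\mathcal A_1\check\otimes\mathcal A_2),$$ the isomorphism being $(a\otimes a')\otimes(b\otimes b')\mapsto(a\otimes b)\otimes(a'\otimes b')$. -/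

import Mathlib

open scoped TensorProduct
open UniformSpace (Completion)

noncomputable section

namespace QuantumMetric

/-! ### Hilbert space tensor products and tensor products of operators -/

section HilbertTensor

/-- The Hilbert space tensor product: the completion of the algebraic tensor product with respect
to the inner product `⟪x ⊗ y, x' ⊗ y'⟫ = ⟪x, x'⟫ * ⟪y, y'⟫`. -/
def HilbertTensor (H K : Type*) [NormedAddCommGroup H] [InnerProductSpace ℂ H]
    [NormedAddCommGroup K] [InnerProductSpace ℂ K] : Type _ :=
  Completion (H ⊗[ℂ] K)

variable {H K L M : Type*}
  [NormedAddCommGroup H] [InnerProductSpace ℂ H]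
  [NormedAddCommGroup K] [InnerProductSpace ℂ K]
  [NormedAddCommGroup L] [InnerProductSpace ℂ L]
  [NormedAddCommGroup M] [InnerProductSpace ℂ M]

instance : NormedAddCommGroup (HilbertTensor H K) :=
  inferInstanceAs (NormedAddCommGroup (Completion (H ⊗[ℂ] K)))

instance : InnerProductSpace ℂ (HilbertTensor H K) :=
  inferInstanceAs (InnerProductSpace ℂ (Completion (H ⊗[ℂ] K)))

instance : CompleteSpace (HilbertTensor H K) :=
  inferInstanceAs (CompleteSpace (Completion (H ⊗[ℂ] K)))

/-- The canonical isometric embedding of the algebraic tensor product. -/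
def emb (H K : Type*) [NormedAddCommGroup H] [InnerProductSpace ℂ H]
    [NormedAddCommGroup K] [InnerProductSpace ℂ K] : H ⊗[ℂ] K →ₗᵢ[ℂ] HilbertTensor H K :=
  (Completion.toComplₗᵢ : H ⊗[ℂ] K →ₗᵢ[ℂ] Completion (H ⊗[ℂ] K))

theorem denseRange_emb : DenseRange (emb H K) :=
  Completion.denseRange_coe (α := H ⊗[ℂ] K)

/-- The elementary tensor `x ⊗ y` in the Hilbert space tensor product. -/
def htmul (x : H) (y : K) : HilbertTensor H K := emb H K (x ⊗ₜ[ℂ] y)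

theorem inner_htmul (x x' : H) (y y' : K) :
    inner ℂ (htmul x y) (htmul x' y') = inner ℂ x x' * inner ℂ y y' := by
  rw [htmul, htmul, LinearIsometry.inner_map_map, TensorProduct.inner_tmul]

/-- The tensor product `S ⊗ T` of bounded operators: the bounded operator on the Hilbert space
tensor product with `(S ⊗ T) (x ⊗ y) = S x ⊗ T y`. -/
def opTensor (S : H →L[ℂ] L) (T : K →L[ℂ] M) : HilbertTensor H K →L[ℂ] HilbertTensor L M :=
  ((emb L M).toContinuousLinearMap.comp (TensorProduct.mapL S T)).extend
    (emb H K).toContinuousLinearMap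

theorem opTensor_emb (S : H →L[ℂ] L) (T : K →L[ℂ] M) (z : H ⊗[ℂ] K) :
    opTensor S T (emb H K z) = emb L M (TensorProduct.mapL S T z) :=
  ContinuousLinearMap.extend_eq _ (e := (emb H K).toContinuousLinearMap)
    denseRange_emb (emb H K).isometry.isUniformInducing z

theorem opTensor_htmul (S : H →L[ℂ] L) (T : K →L[ℂ] M) (x : H) (y : K) :
    opTensor S T (htmul x y) = htmul (S x) (T y) := by
  rw [htmul, opTensor_emb]; rfl

/-- The span of the elementary tensors is dense. -/
theorem denseRange_tensor_map {X X' Y Y' : Type*}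
    [NormedAddCommGroup X] [InnerProductSpace ℂ X] [NormedAddCommGroup X'] [InnerProductSpace ℂ X']
    [NormedAddCommGroup Y] [InnerProductSpace ℂ Y] [NormedAddCommGroup Y'] [InnerProductSpace ℂ Y']
    (e : X →ₗᵢ[ℂ] X') (f : Y →ₗᵢ[ℂ] Y') (he : DenseRange e) (hf : DenseRange f) :
    DenseRange ((emb X' Y').comp (TensorProduct.mapIsometry e f)) := by
  have key : DenseRange (TensorProduct.mapIsometry e f) := by
    have hcl : ∀ z : X' ⊗[ℂ] Y',
        z ∈ (LinearMap.range (TensorProduct.mapIsometry e f).toLinearMap).topologicalClosure := by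
      intro z
      induction z with
      | zero => exact Submodule.zero_mem _
      | add a b ha hb => exact Submodule.add_mem _ ha hb
      | tmul x y =>
        have hd : DenseRange (Prod.map e f) := he.prodMap hf
        have hc : Continuous fun p : X' × Y' => (p.1 ⊗ₜ[ℂ] p.2 : X' ⊗[ℂ] Y') :=
          TensorProduct.continuous_tmul
        refine hd.induction_on (p := fun p : X' × Y' => p.1 ⊗ₜ[ℂ] p.2 ∈
          (LinearMap.range (TensorProduct.mapIsometry e f).toLinearMap).topologicalClosure)
          (x, y) ?_ ?_
        · exact (Submodule.isClosed_topologicalClosure _).preimage hc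
        · rintro ⟨a, b⟩
          exact Submodule.le_topologicalClosure _ ⟨a ⊗ₜ[ℂ] b, by simp⟩
    intro z
    exact hcl z
  exact denseRange_emb.comp key (emb X' Y').continuous

/-- The canonical isometric embedding of `(H ⊗ K) ⊗ L` (algebraic) into the Hilbert space tensor
product of `H ⊗ K` and `L`. -/
def embLeft (H K L : Type*) [NormedAddCommGroup H] [InnerProductSpace ℂ H]
    [NormedAddCommGroup K] [InnerProductSpace ℂ K] [NormedAddCommGroup L] [InnerProductSpace ℂ L] :
    (H ⊗[ℂ] K) ⊗[ℂ] L →ₗᵢ[ℂ] HilbertTensor (HilbertTensor H K) L :=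
  (emb (HilbertTensor H K) L).comp (TensorProduct.mapIsometry (emb H K) LinearIsometry.id)

/-- The canonical isometric embedding of `H ⊗ (K ⊗ L)` (algebraic) into the Hilbert space tensor
product of `H` and `K ⊗ L`. -/
def embRight (H K L : Type*) [NormedAddCommGroup H] [InnerProductSpace ℂ H]
    [NormedAddCommGroup K] [InnerProductSpace ℂ K] [NormedAddCommGroup L] [InnerProductSpace ℂ L] :
    H ⊗[ℂ] (K ⊗[ℂ] L) →ₗᵢ[ℂ] HilbertTensor H (HilbertTensor K L) :=
  (emb H (HilbertTensor K L)).comp (TensorProduct.mapIsometry LinearIsometry.id (emb K L))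

/-- The canonical isometric embedding of `(H ⊗ K) ⊗ (L ⊗ M)` (algebraic) into the Hilbert space
tensor product of `H ⊗ K` and `L ⊗ M`. -/
def embBoth (H K L M : Type*) [NormedAddCommGroup H] [InnerProductSpace ℂ H]
    [NormedAddCommGroup K] [InnerProductSpace ℂ K] [NormedAddCommGroup L] [InnerProductSpace ℂ L]
    [NormedAddCommGroup M] [InnerProductSpace ℂ M] :
    (H ⊗[ℂ] K) ⊗[ℂ] (L ⊗[ℂ] M) →ₗᵢ[ℂ] HilbertTensor (HilbertTensor H K) (HilbertTensor L M) :=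
  (emb (HilbertTensor H K) (HilbertTensor L M)).comp
    (TensorProduct.mapIsometry (emb H K) (emb L M))

theorem denseRange_embLeft : DenseRange (embLeft H K L) :=
  denseRange_tensor_map _ _ denseRange_emb Function.surjective_id.denseRange

theorem denseRange_embRight : DenseRange (embRight H K L) :=
  denseRange_tensor_map _ _ Function.surjective_id.denseRange denseRange_emb

theorem denseRange_embBoth : DenseRange (embBoth H K L M) :=
  denseRange_tensor_map _ _ denseRange_emb denseRange_emb

/-- The unitary `H ⊗ K ≅ K ⊗ H`, `x ⊗ y ↦ y ⊗ x`. -/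
def hcomm (H K : Type*) [NormedAddCommGroup H] [InnerProductSpace ℂ H]
    [NormedAddCommGroup K] [InnerProductSpace ℂ K] :
    HilbertTensor H K ≃ₗᵢ[ℂ] HilbertTensor K H :=
  (TensorProduct.comm ℂ H K).extendOfIsometry
    (emb H K).toLinearMap
    (emb K H).toLinearMap
    denseRange_emb denseRange_emb
    (fun x => ((emb K H).norm_map _).trans
      ((TensorProduct.norm_comm x).trans ((emb H K).norm_map x).symm))

/-- The unitary `(H ⊗ K) ⊗ L ≅ H ⊗ (K ⊗ L)`, `(x ⊗ y) ⊗ z ↦ x ⊗ (y ⊗ z)`. -/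
def hassoc (H K L : Type*) [NormedAddCommGroup H] [InnerProductSpace ℂ H]
    [NormedAddCommGroup K] [InnerProductSpace ℂ K] [NormedAddCommGroup L] [InnerProductSpace ℂ L] :
    HilbertTensor (HilbertTensor H K) L ≃ₗᵢ[ℂ] HilbertTensor H (HilbertTensor K L) :=
  (TensorProduct.assoc ℂ H K L).extendOfIsometry
    (embLeft H K L).toLinearMap (embRight H K L).toLinearMap
    denseRange_embLeft denseRange_embRight
    (fun x => ((embRight H K L).norm_map _).trans
      ((TensorProduct.norm_assoc x).trans ((embLeft H K L).norm_map x).symm))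

/-- The isometry `(H ⊗ K) ⊗ L ≅ (H ⊗ L) ⊗ K`, `(x ⊗ y) ⊗ z ↦ (x ⊗ z) ⊗ y`, on algebraic tensor
products. -/
def rightCommIsometry (H K L : Type*) [NormedAddCommGroup H] [InnerProductSpace ℂ H]
    [NormedAddCommGroup K] [InnerProductSpace ℂ K] [NormedAddCommGroup L] [InnerProductSpace ℂ L] :
    (H ⊗[ℂ] K) ⊗[ℂ] L ≃ₗᵢ[ℂ] (H ⊗[ℂ] L) ⊗[ℂ] K :=
  ((TensorProduct.assocIsometry ℂ H K L).trans
    ((TensorProduct.commIsometry ℂ K L).lTensor H)).trans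
      (TensorProduct.assocIsometry ℂ H L K).symm

/-- The isometry `(H ⊗ K) ⊗ (L ⊗ M) ≅ (H ⊗ L) ⊗ (K ⊗ M)`,
`(x ⊗ y) ⊗ (z ⊗ w) ↦ (x ⊗ z) ⊗ (y ⊗ w)`, on algebraic tensor products. -/
def interchangeIsometry (H K L M : Type*) [NormedAddCommGroup H] [InnerProductSpace ℂ H]
    [NormedAddCommGroup K] [InnerProductSpace ℂ K] [NormedAddCommGroup L] [InnerProductSpace ℂ L]
    [NormedAddCommGroup M] [InnerProductSpace ℂ M] :
    (H ⊗[ℂ] K) ⊗[ℂ] (L ⊗[ℂ] M) ≃ₗᵢ[ℂ] (H ⊗[ℂ] L) ⊗[ℂ] (K ⊗[ℂ] M) :=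
  ((TensorProduct.assocIsometry ℂ (H ⊗[ℂ] K) L M).symm.trans
    ((rightCommIsometry H K L).rTensor M)).trans
      (TensorProduct.assocIsometry ℂ (H ⊗[ℂ] L) K M)

/-- The unitary `(H ⊗ K) ⊗ L ≅ (H ⊗ L) ⊗ K`, `(x ⊗ y) ⊗ z ↦ (x ⊗ z) ⊗ y`. -/
def hrightComm (H K L : Type*) [NormedAddCommGroup H] [InnerProductSpace ℂ H]
    [NormedAddCommGroup K] [InnerProductSpace ℂ K] [NormedAddCommGroup L] [InnerProductSpace ℂ L] :
    HilbertTensor (HilbertTensor H K) L ≃ₗᵢ[ℂ] HilbertTensor (HilbertTensor H L) K :=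
  (rightCommIsometry H K L).toLinearEquiv.extendOfIsometry
    (embLeft H K L).toLinearMap (embLeft H L K).toLinearMap
    denseRange_embLeft denseRange_embLeft
    (fun x => ((embLeft H L K).norm_map _).trans
      (((rightCommIsometry H K L).norm_map x).trans ((embLeft H K L).norm_map x).symm))

/-- The unitary `(H ⊗ K) ⊗ (L ⊗ M) ≅ (H ⊗ L) ⊗ (K ⊗ M)`,
`(x ⊗ y) ⊗ (z ⊗ w) ↦ (x ⊗ z) ⊗ (y ⊗ w)`. -/
def hinterchange (H K L M : Type*) [NormedAddCommGroup H] [InnerProductSpace ℂ H]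
    [NormedAddCommGroup K] [InnerProductSpace ℂ K] [NormedAddCommGroup L] [InnerProductSpace ℂ L]
    [NormedAddCommGroup M] [InnerProductSpace ℂ M] :
    HilbertTensor (HilbertTensor H K) (HilbertTensor L M) ≃ₗᵢ[ℂ]
      HilbertTensor (HilbertTensor H L) (HilbertTensor K M) :=
  (interchangeIsometry H K L M).toLinearEquiv.extendOfIsometry
    (embBoth H K L M).toLinearMap (embBoth H L K M).toLinearMap
    denseRange_embBoth denseRange_embBoth
    (fun x => ((embBoth H L K M).norm_map _).trans
      (((interchangeIsometry H K L M).norm_map x).trans ((embBoth H K L M).norm_map x).symm))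

theorem hcomm_htmul (x : H) (y : K) : hcomm H K (htmul x y) = htmul y x :=
  LinearEquiv.extendOfIsometry_eq (TensorProduct.comm ℂ H K) _ _
    denseRange_emb denseRange_emb _ (x ⊗ₜ[ℂ] y)

theorem hassoc_htmul (x : H) (y : K) (z : L) :
    hassoc H K L (htmul (htmul x y) z) = htmul x (htmul y z) :=
  LinearEquiv.extendOfIsometry_eq (TensorProduct.assoc ℂ H K L) _ _
    denseRange_embLeft denseRange_embRight _ ((x ⊗ₜ[ℂ] y) ⊗ₜ[ℂ] z)

theorem hrightComm_htmul (x : H) (y : K) (z : L) :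
    hrightComm H K L (htmul (htmul x y) z) = htmul (htmul x z) y :=
  LinearEquiv.extendOfIsometry_eq (rightCommIsometry H K L).toLinearEquiv _ _
    denseRange_embLeft denseRange_embLeft _ ((x ⊗ₜ[ℂ] y) ⊗ₜ[ℂ] z)

theorem hinterchange_htmul (x : H) (y : K) (z : L) (w : M) :
    hinterchange H K L M (htmul (htmul x y) (htmul z w)) = htmul (htmul x z) (htmul y w) :=
  LinearEquiv.extendOfIsometry_eq (interchangeIsometry H K L M).toLinearEquiv _ _
    denseRange_embBoth denseRange_embBoth _ ((x ⊗ₜ[ℂ] y) ⊗ₜ[ℂ] (z ⊗ₜ[ℂ] w))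

end HilbertTensor

/-! ### Representations -/

section Representations

variable {A : Type*} [CStarAlgebra A]

/-- A (unital) representation on a Hilbert space `H` is irreducible if `H ≠ 0` and the only closed
invariant subspaces are `0` and `H`. -/
def IsIrreducibleRep {H : Type*} [NormedAddCommGroup H] [InnerProductSpace ℂ H] [CompleteSpace H]
    (π : A →⋆ₐ[ℂ] (H →L[ℂ] H)) : Prop :=
  Nontrivial H ∧ ∀ V : Submodule ℂ H, IsClosed (V : Set H) →
    (∀ a : A, ∀ x ∈ V, π a x ∈ V) → V = ⊥ ∨ V = ⊤

/-- Unitary equivalence of representations. -/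
def EquivalentReps {H K : Type*}
    [NormedAddCommGroup H] [InnerProductSpace ℂ H] [CompleteSpace H]
    [NormedAddCommGroup K] [InnerProductSpace ℂ K] [CompleteSpace K]
    (π : A →⋆ₐ[ℂ] (H →L[ℂ] H)) (σ : A →⋆ₐ[ℂ] (K →L[ℂ] K)) : Prop :=
  ∃ U : H ≃ₗᵢ[ℂ] K, ∀ (a : A) (x : H), U (π a x) = σ a (U x)

/-- A representation is atomic if it is (unitarily equivalent to) the Hilbert direct sum of a family
of pairwise inequivalent irreducible representations. The summands embed in `H`, so it is no
restriction to take them, and their index set, in the universe of `H`. -/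
def IsAtomicRep.{u, v} {A : Type v} [CStarAlgebra A] {H : Type u} [NormedAddCommGroup H] [InnerProductSpace ℂ H] [CompleteSpace H]
    (π : A →⋆ₐ[ℂ] (H →L[ℂ] H)) : Prop :=
  ∃ (ι : Type u) (E : ι → Type u)
    (_ : ∀ i, NormedAddCommGroup (E i)) (_ : ∀ i, InnerProductSpace ℂ (E i))
    (_ : ∀ i, CompleteSpace (E i)) (σ : ∀ i, A →⋆ₐ[ℂ] (E i →L[ℂ] E i)),
    (∀ i, IsIrreducibleRep (σ i)) ∧
    (∀ i j, i ≠ j → ¬ EquivalentReps (σ i) (σ j)) ∧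
    ∃ U : H ≃ₗᵢ[ℂ] lp E 2, ∀ (a : A) (x : H) (i : ι), U (π a x) i = σ i a (U x i)

end Representations

/-! ### Spatial tensor product -/

section Spatial

variable {A B : Type*} [CStarAlgebra A] [CStarAlgebra B]
  {H K : Type*} [NormedAddCommGroup H] [InnerProductSpace ℂ H] [CompleteSpace H]
  [NormedAddCommGroup K] [InnerProductSpace ℂ K] [CompleteSpace K]

/-- The spatial tensor product of two C⋆-algebras, realised through (faithful) representations `π`
and `σ`: the C⋆-algebra of operators on the Hilbert space tensor product that is generated by the
operators `π a ⊗ σ b`. -/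
def spatialTensor (π : A →⋆ₐ[ℂ] (H →L[ℂ] H)) (σ : B →⋆ₐ[ℂ] (K →L[ℂ] K)) :
    StarSubalgebra ℂ (HilbertTensor H K →L[ℂ] HilbertTensor H K) :=
  (StarAlgebra.adjoin ℂ {T | ∃ (a : A) (b : B), T = opTensor (π a) (σ b)}).topologicalClosure

instance spatialTensor_isClosed (π : A →⋆ₐ[ℂ] (H →L[ℂ] H)) (σ : B →⋆ₐ[ℂ] (K →L[ℂ] K)) :
    IsClosed (spatialTensor π σ : Set (HilbertTensor H K →L[ℂ] HilbertTensor H K)) :=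
  StarSubalgebra.isClosed_topologicalClosure _

/-- The tensor product representation `π ⊗ σ` of the spatial tensor product. As the latter is
realised as an algebra of operators on the Hilbert space tensor product, this is the inclusion. -/
def tensorRep (π : A →⋆ₐ[ℂ] (H →L[ℂ] H)) (σ : B →⋆ₐ[ℂ] (K →L[ℂ] K)) :
    spatialTensor π σ →⋆ₐ[ℂ] (HilbertTensor H K →L[ℂ] HilbertTensor H K) :=
  (spatialTensor π σ).subtype

end Spatial

/-! ### Quantum metrics -/

section QuantumMetrics

variable {A : Type*} [CStarAlgebra A]
  {H : Type*} [NormedAddCommGroup H] [InnerProductSpace ℂ H] [CompleteSpace H]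

/-- The enveloping von Neumann algebra `π(A)''`, the bicommutant of the range of `π`. -/
def envelopingAlgebra (π : A →⋆ₐ[ℂ] (H →L[ℂ] H)) : Set (H →L[ℂ] H) :=
  Set.centralizer (Set.centralizer (Set.range π))

/-- `p` is a minimal projection of the algebra `N` of operators. -/
def IsMinimalProjection (N : Set (H →L[ℂ] H)) (p : H →L[ℂ] H) : Prop :=
  p ∈ N ∧ IsStarProjection p ∧ p ≠ 0 ∧
    ∀ q ∈ N, IsStarProjection q → q ≤ p → q = 0 ∨ q = p

/-- The subspace `H_δ`: the closed linear span of the ranges of the projections `p ⊗ p`, for `p` a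
minimal projection of `π(A)''`. -/
def diagonalSubspace (π : A →⋆ₐ[ℂ] (H →L[ℂ] H)) : Submodule ℂ (HilbertTensor H H) :=
  (⨆ p : {p : H →L[ℂ] H // IsMinimalProjection (envelopingAlgebra π) p},
    LinearMap.range (opTensor p.1 p.1).toLinearMap).topologicalClosure

instance (π : A →⋆ₐ[ℂ] (H →L[ℂ] H)) : CompleteSpace (diagonalSubspace π) :=
  Submodule.topologicalClosure.completeSpace _

/-- The characteristic function of the diagonal, `P_δ`: the supremum of the projections `p ⊗ p`, for
`p` a minimal projection of `π(A)''`, that is, the orthogonal projection onto the closed linear span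
of their ranges. -/
def diagonalProjection (π : A →⋆ₐ[ℂ] (H →L[ℂ] H)) : HilbertTensor H H →L[ℂ] HilbertTensor H H :=
  (diagonalSubspace π).starProjection

/-- The flip `a ⊗ b ↦ b ⊗ a`. -/
def flip (T : HilbertTensor H H →L[ℂ] HilbertTensor H H) :
    HilbertTensor H H →L[ℂ] HilbertTensor H H :=
  (hcomm H H).conjStarAlgEquiv T

/-- `T ↦ T ⊗ 1`, on the Hilbert space tensor product `(H ⊗ H) ⊗ H`. -/
def tensorOne (T : HilbertTensor H H →L[ℂ] HilbertTensor H H) :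
    HilbertTensor (HilbertTensor H H) H →L[ℂ] HilbertTensor (HilbertTensor H H) H :=
  opTensor T (ContinuousLinearMap.id ℂ H)

/-- `T ↦ 1 ⊗ T`, on the Hilbert space tensor product `(H ⊗ H) ⊗ H ≅ H ⊗ (H ⊗ H)`. -/
def oneTensor (T : HilbertTensor H H →L[ℂ] HilbertTensor H H) :
    HilbertTensor (HilbertTensor H H) H →L[ℂ] HilbertTensor (HilbertTensor H H) H :=
  (hassoc H H H).symm.conjStarAlgEquiv (opTensor (ContinuousLinearMap.id ℂ H) T)

/-- The morphism `a ⊗ b ↦ a ⊗ 1 ⊗ b`. -/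
def midOne (T : HilbertTensor H H →L[ℂ] HilbertTensor H H) :
    HilbertTensor (HilbertTensor H H) H →L[ℂ] HilbertTensor (HilbertTensor H H) H :=
  (hrightComm H H H).conjStarAlgEquiv (tensorOne T)

/-- `(A, ρ, π)` is a compact quantum metric space. Here `A` is a unital C⋆-algebra, `π` is a
representation of `A` on `H`, and `A ⊗ A` is regarded as an algebra of operators on `H ⊗ H`. -/
structure IsCompactQuantumMetricSpace (π : A →⋆ₐ[ℂ] (H →L[ℂ] H))
    (ρ : HilbertTensor H H →L[ℂ] HilbertTensor H H) : Prop where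
  faithful : Function.Injective π
  atomic : IsAtomicRep π
  mem : ρ ∈ spatialTensor π π
  nonneg : 0 ≤ ρ
  mul_diagonal : ρ * diagonalProjection π = 0
  diagonal_mul : diagonalProjection π * ρ = 0
  /-- `0` is not an eigenvalue of `ρ` on the orthogonal complement of `H_δ`. -/
  eq_zero_of_apply_eq_zero : ∀ x ∈ (diagonalSubspace π)ᗮ, ρ x = 0 → x = 0
  flip_eq : flip ρ = ρ
  triangle : midOne ρ ≤ tensorOne ρ + oneTensor ρ

end QuantumMetrics

/-- The element `ρ₁ ⊗ 1 + 1 ⊗ ρ₂` of `(A₁ ⊗ A₁) ⊗ (A₂ ⊗ A₂)`, transported to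
`(A₁ ⊗ A₂) ⊗ (A₁ ⊗ A₂)` by the reordering `(a ⊗ a') ⊗ (b ⊗ b') ↦ (a ⊗ b) ⊗ (a' ⊗ b')`. -/
def sumMetric {H₁ H₂ : Type*}
    [NormedAddCommGroup H₁] [InnerProductSpace ℂ H₁] [CompleteSpace H₁]
    [NormedAddCommGroup H₂] [InnerProductSpace ℂ H₂] [CompleteSpace H₂]
    (ρ₁ : HilbertTensor H₁ H₁ →L[ℂ] HilbertTensor H₁ H₁)
    (ρ₂ : HilbertTensor H₂ H₂ →L[ℂ] HilbertTensor H₂ H₂) :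
    HilbertTensor (HilbertTensor H₁ H₂) (HilbertTensor H₁ H₂) →L[ℂ]
      HilbertTensor (HilbertTensor H₁ H₂) (HilbertTensor H₁ H₂) :=
  (hinterchange H₁ H₁ H₂ H₂).conjStarAlgEquiv
    (opTensor ρ₁ (ContinuousLinearMap.id ℂ (HilbertTensor H₂ H₂)) +
      opTensor (ContinuousLinearMap.id ℂ (HilbertTensor H₁ H₁)) ρ₂)

end QuantumMetric

end

/-! The axioms force the algebra to act diagonally, so that the theorem reduces to the fact that a
sum of two metrics is a metric on the product.

The commutant of an atomic representation acts on each irreducible summand by scalars (Schur), so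
the minimal projections of the bicommutant are the rank one projections onto lines inside summands.
Hence the diagonal subspace is the closed span of the tensors `x ⊗ x` with `x` in a summand
(`diagonalSubspace_eq`), and `ρ` kills these. For `x`, `y` in one summand, the positive operator `ρ
⊗ 1 + 1 ⊗ ρ - 𝔐(ρ)` has vanishing quadratic form at `x ⊗ x ⊗ y`, so it annihilates this vector; one
matrix coefficient of that identity, with polarization, gives `ρ (x ⊗ y) = 0`
(`apply_htmul_eq_zero`). But `x ⊗ y - y ⊗ x` is orthogonal to the diagonal subspace, where `ρ` has
no kernel, so `x ⊗ y = y ⊗ x` and every summand is a line.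

Unit vectors of these lines form a Hilbert basis `b` of joint eigenvectors with distinct characters.
Then `ρ (b i ⊗ b j) = d i j • b i ⊗ b j`, and the axioms on `ρ` make `d` a metric (`isMetricOf`).
Conversely, an element of the spatial tensor product with a metric as diagonal satisfies all the
axioms (`IsMetricOf.isCompactQuantumMetricSpace`). The product basis again diagonalises with
distinct characters, and `ρ₁ ⊗ 1 + 1 ⊗ ρ₂` has diagonal `d + e`. -/

noncomputable section

namespace QuantumMetric

open InnerProductSpace (rankOne)

/-! ### Elementary tensors, product bases and tensor products of operators -/

section TensorVectors

variable {H K L M : Type*}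
  [NormedAddCommGroup H] [InnerProductSpace ℂ H]
  [NormedAddCommGroup K] [InnerProductSpace ℂ K]
  [NormedAddCommGroup L] [InnerProductSpace ℂ L]
  [NormedAddCommGroup M] [InnerProductSpace ℂ M]

/-- The elementary tensor as a continuous bilinear map. -/
def htmulL (H K : Type*) [NormedAddCommGroup H] [InnerProductSpace ℂ H]
    [NormedAddCommGroup K] [InnerProductSpace ℂ K] : H →L[ℂ] K →L[ℂ] HilbertTensor H K :=
  (ContinuousLinearMap.compL ℂ K (H ⊗[ℂ] K) (HilbertTensor H K)
    (emb H K).toContinuousLinearMap).comp (TensorProduct.mkL ℂ H K)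

theorem htmulL_apply (x : H) (y : K) : htmulL H K x y = htmul x y := rfl

theorem add_htmul (x x' : H) (y : K) : htmul (x + x') y = htmul x y + htmul x' y := by
  simp [← htmulL_apply]

theorem htmul_add (x : H) (y y' : K) : htmul x (y + y') = htmul x y + htmul x y' := by
  simp [← htmulL_apply]

theorem smul_htmul (c : ℂ) (x : H) (y : K) : htmul (c • x) y = c • htmul x y := by
  simp [← htmulL_apply]

theorem htmul_smul (c : ℂ) (x : H) (y : K) : htmul x (c • y) = c • htmul x y := by
  simp [← htmulL_apply]

theorem zero_htmul (y : K) : htmul (0 : H) y = 0 := by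
  simp [← htmulL_apply]

theorem norm_htmul (x : H) (y : K) : ‖htmul x y‖ = ‖x‖ * ‖y‖ := by
  rw [htmul, LinearIsometry.norm_map, TensorProduct.norm_tmul]

/-- Bounded operators on a Hilbert space tensor product that agree on elementary tensors are
equal. -/
theorem ext_htmul {S T : HilbertTensor H K →L[ℂ] L}
    (h : ∀ x y, S (htmul x y) = T (htmul x y)) : S = T := by
  refine DFunLike.coe_injective (denseRange_emb.equalizer S.continuous T.continuous ?_)
  funext z
  induction z with
  | zero => simp
  | tmul x y => exact h x y
  | add a b ha hb => simp only [Function.comp_apply, map_add] at ha hb ⊢; rw [ha, hb]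

theorem eq_zero_of_inner_htmul {z : HilbertTensor H K} (h : ∀ x y, inner ℂ z (htmul x y) = 0) :
    z = 0 := by
  have : innerSL ℂ z = 0 := ext_htmul fun x y => by simpa using h x y
  simpa using DFunLike.congr_fun this z

theorem inner_eq_zero_of_hilbertBasis {ι : Type*} (b : HilbertBasis ι ℂ H) {z : H}
    (h : ∀ i, inner ℂ (b i) z = 0) : z = 0 :=
  b.repr.injective <| by
    ext i
    simpa [b.repr_apply_apply] using h i

theorem ext_hilbertBasis {ι : Type*} (b : HilbertBasis ι ℂ H) {S T : H →L[ℂ] L}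
    (h : ∀ i, S (b i) = T (b i)) : S = T := by
  refine ContinuousLinearMap.ext_on
    (s := Set.range b) ((Submodule.dense_iff_topologicalClosure_eq_top).2 b.dense_span) ?_
  rintro _ ⟨i, rfl⟩
  exact h i

/-- The tensor product of two Hilbert bases. -/
def tensorBasis {ι κ : Type*} (b : HilbertBasis ι ℂ H) (c : HilbertBasis κ ℂ K) :
    HilbertBasis (ι × κ) ℂ (HilbertTensor H K) :=
  HilbertBasis.mkOfOrthogonalEqBot (v := fun p : ι × κ => htmul (b p.1) (c p.2))
    (by
      classical
      rw [orthonormal_iff_ite]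
      rintro ⟨i, j⟩ ⟨k, l⟩
      simp only [inner_htmul, orthonormal_iff_ite.1 b.orthonormal,
        orthonormal_iff_ite.1 c.orthonormal, Prod.mk.injEq]
      split_ifs <;> simp_all)
    (by
      rw [Submodule.eq_bot_iff]
      intro z hz
      have hz' : ∀ i j, inner ℂ z (htmul (b i) (c j)) = 0 := fun i j =>
        (Submodule.mem_orthogonal' _ _).1 hz _ (Submodule.subset_span ⟨(i, j), rfl⟩)
      -- One factor is freed at a time: a bounded functional vanishing on a Hilbert basis is zero.
      have h1 : ∀ i y, inner ℂ z (htmul (b i) y) = 0 := fun i y => by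
        have : (innerSL ℂ z).comp (htmulL H K (b i)) = 0 :=
          ext_hilbertBasis c fun j => by simpa [htmulL_apply] using hz' i j
        simpa [htmulL_apply] using DFunLike.congr_fun this y
      refine eq_zero_of_inner_htmul fun x y => ?_
      have : (innerSL ℂ z).comp ((htmulL H K).flip y) = 0 :=
        ext_hilbertBasis b fun i => by simpa [htmulL_apply] using h1 i y
      simpa [htmulL_apply] using DFunLike.congr_fun this x)

theorem tensorBasis_apply {ι κ : Type*} (b : HilbertBasis ι ℂ H) (c : HilbertBasis κ ℂ K)
    (p : ι × κ) : tensorBasis b c p = htmul (b p.1) (c p.2) := by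
  simp [tensorBasis]

theorem opTensor_mul (S S' : H →L[ℂ] H) (T T' : K →L[ℂ] K) :
    opTensor (S * S') (T * T') = opTensor S T * opTensor S' T' :=
  ext_htmul fun x y => by simp [opTensor_htmul]

theorem opTensor_one : opTensor (1 : H →L[ℂ] H) (1 : K →L[ℂ] K) = 1 :=
  ext_htmul fun x y => by simp [opTensor_htmul]

theorem opTensor_add_left (S S' : H →L[ℂ] L) (T : K →L[ℂ] M) :
    opTensor (S + S') T = opTensor S T + opTensor S' T :=
  ext_htmul fun x y => by simp [opTensor_htmul, add_htmul]

theorem opTensor_add_right (S : H →L[ℂ] L) (T T' : K →L[ℂ] M) :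
    opTensor S (T + T') = opTensor S T + opTensor S T' :=
  ext_htmul fun x y => by simp [opTensor_htmul, htmul_add]

theorem opTensor_smul_left (c : ℂ) (S : H →L[ℂ] L) (T : K →L[ℂ] M) :
    opTensor (c • S) T = c • opTensor S T :=
  ext_htmul fun x y => by simp [opTensor_htmul, smul_htmul]

theorem opTensor_smul_right (c : ℂ) (S : H →L[ℂ] L) (T : K →L[ℂ] M) :
    opTensor S (c • T) = c • opTensor S T :=
  ext_htmul fun x y => by simp [opTensor_htmul, htmul_smul]

theorem star_opTensor [CompleteSpace H] [CompleteSpace K] (S : H →L[ℂ] H) (T : K →L[ℂ] K) :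
    star (opTensor S T) = opTensor (star S) (star T) := by
  refine ext_htmul fun x y => sub_eq_zero.1 (eq_zero_of_inner_htmul fun x' y' => ?_)
  rw [inner_sub_left, ContinuousLinearMap.star_eq_adjoint, ContinuousLinearMap.adjoint_inner_left,
    opTensor_htmul, opTensor_htmul, inner_htmul, inner_htmul,
    ContinuousLinearMap.star_eq_adjoint, ContinuousLinearMap.star_eq_adjoint,
    ContinuousLinearMap.adjoint_inner_left, ContinuousLinearMap.adjoint_inner_left, sub_self]

/-- `T ↦ T ⊗ 1` as a morphism of C⋆-algebras. -/
def amplifyLeft (H K : Type*) [NormedAddCommGroup H] [InnerProductSpace ℂ H] [CompleteSpace H]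
    [NormedAddCommGroup K] [InnerProductSpace ℂ K] [CompleteSpace K] :
    (H →L[ℂ] H) →⋆ₐ[ℂ] (HilbertTensor H K →L[ℂ] HilbertTensor H K) where
  toFun T := opTensor T 1
  map_one' := opTensor_one
  map_mul' S T := by rw [← opTensor_mul, one_mul]
  map_zero' := by simpa using opTensor_smul_left (0 : ℂ) (0 : H →L[ℂ] H) (1 : K →L[ℂ] K)
  map_add' S T := opTensor_add_left S T 1
  commutes' c := by
    simp only [Algebra.algebraMap_eq_smul_one, opTensor_smul_left, opTensor_one]
  map_star' T := by rw [star_opTensor, star_one]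

/-- `T ↦ 1 ⊗ T` as a morphism of C⋆-algebras. -/
def amplifyRight (H K : Type*) [NormedAddCommGroup H] [InnerProductSpace ℂ H] [CompleteSpace H]
    [NormedAddCommGroup K] [InnerProductSpace ℂ K] [CompleteSpace K] :
    (K →L[ℂ] K) →⋆ₐ[ℂ] (HilbertTensor H K →L[ℂ] HilbertTensor H K) where
  toFun T := opTensor 1 T
  map_one' := opTensor_one
  map_mul' S T := by rw [← opTensor_mul, one_mul]
  map_zero' := by simpa using opTensor_smul_right (0 : ℂ) (1 : H →L[ℂ] H) (0 : K →L[ℂ] K)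
  map_add' S T := opTensor_add_right 1 S T
  commutes' c := by
    simp only [Algebra.algebraMap_eq_smul_one, opTensor_smul_right, opTensor_one]
  map_star' T := by rw [star_opTensor, star_one]

/-- With `y = x` a unit vector, this identifies `p ⊗ p`, for `p` the projection onto the line of
`x`, as the projection onto the line of `x ⊗ x`. -/
theorem opTensor_rankOne (x : H) (y : K) :
    opTensor (rankOne ℂ x x) (rankOne ℂ y y) =
      rankOne ℂ (htmul x y) (htmul x y) :=
  ext_htmul fun x' y' => by
    simp [opTensor_htmul, inner_htmul, smul_htmul, htmul_smul, smul_smul, mul_comm]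

end TensorVectors

/-! ### Positive operators -/

/-- A positive operator annihilates the vectors on which its quadratic form vanishes. -/
theorem apply_eq_zero_of_inner_eq_zero {H : Type*} [NormedAddCommGroup H] [InnerProductSpace ℂ H]
    [CompleteSpace H] {T : H →L[ℂ] H} (hT : 0 ≤ T) {x : H} (hx : inner ℂ x (T x) = 0) :
    T x = 0 := by
  obtain ⟨S, rfl⟩ := CStarAlgebra.nonneg_iff_eq_star_mul_self.1 hT
  -- Since `T = S* S`, the hypothesis says that `S x` has norm zero.
  have : S x = 0 := by
    rw [mul_apply_eq_comp, ContinuousLinearMap.star_eq_adjoint,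
      ContinuousLinearMap.adjoint_inner_right] at hx
    exact inner_self_eq_zero.1 hx
  simp [this]

/-- An operator that is diagonal with nonnegative eigenvalues in a Hilbert basis is positive. -/
theorem nonneg_of_hilbertBasis {ι H : Type*} [NormedAddCommGroup H] [InnerProductSpace ℂ H]
    [CompleteSpace H] (b : HilbertBasis ι ℂ H) {T : H →L[ℂ] H} {d : ι → ℝ} (hd : ∀ i, 0 ≤ d i)
    (hT : ∀ i, T (b i) = (d i : ℂ) • b i) : 0 ≤ T := by
  -- Self-adjointness of `T` is not assumed; both sides are bounded functionals of `x`, so they are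
  -- compared on the basis.
  have hT' : ∀ i x, inner ℂ (b i) (T x) = d i * inner ℂ (b i) x := fun i x => by
    have : (innerSL ℂ (b i)).comp T = (d i : ℂ) • innerSL ℂ (b i) := by
      classical
      refine ext_hilbertBasis b fun j => ?_
      simp only [ContinuousLinearMap.comp_apply, hT, innerSL_apply_apply, inner_smul_right,
        smul_apply, smul_eq_mul, orthonormal_iff_ite.1 b.orthonormal]
      split_ifs with h <;> simp [h]
    simpa using DFunLike.congr_fun this x
  rw [ContinuousLinearMap.nonneg_iff_isPositive, ContinuousLinearMap.isPositive_iff_complex]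
  intro x
  -- Parseval turns the quadratic form into a series with nonnegative real terms.
  have key : HasSum (fun i => ((d i * ‖inner ℂ (b i) x‖ ^ 2 : ℝ) : ℂ)) (inner ℂ x (T x)) := by
    have h : (fun i => ((d i * ‖inner ℂ (b i) x‖ ^ 2 : ℝ) : ℂ)) =
        fun i => inner ℂ x (b i) * inner ℂ (b i) (T x) := by
      funext i
      rw [hT', ← inner_conj_symm x (b i), mul_left_comm, RCLike.conj_mul]
      push_cast
      rfl
    rw [h]
    exact b.hasSum_inner_mul_inner x (T x)
  have him : (inner ℂ x (T x)).im = 0 :=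
    (Complex.hasSum_im key).unique (by simp only [Complex.ofReal_im]; exact hasSum_zero)
  have hre : 0 ≤ (inner ℂ x (T x)).re :=
    (Complex.hasSum_re key).nonneg fun i => by
      rw [Complex.ofReal_re]
      exact mul_nonneg (hd i) (sq_nonneg _)
  rw [← inner_conj_symm (T x) x]
  refine ⟨?_, ?_⟩
  · apply Complex.ext <;> simp only [RCLike.re_to_complex, Complex.conj_re, Complex.conj_im,
      Complex.ofReal_re, Complex.ofReal_im, him, neg_zero]
  · simpa only [RCLike.re_to_complex, Complex.conj_re] using hre

/-! ### Schur's lemma -/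

section Schur

variable {A : Type*} [CStarAlgebra A]
  {E F : Type*} [NormedAddCommGroup E] [InnerProductSpace ℂ E] [CompleteSpace E]
  [NormedAddCommGroup F] [InnerProductSpace ℂ F] [CompleteSpace F]
  {σ : A →⋆ₐ[ℂ] (E →L[ℂ] E)} {τ : A →⋆ₐ[ℂ] (F →L[ℂ] F)}

theorem inner_star_rep (σ : A →⋆ₐ[ℂ] (E →L[ℂ] E)) (a : A) (x y : E) :
    inner ℂ (σ (star a) x) y = inner ℂ x (σ a y) := by
  rw [map_star, ContinuousLinearMap.star_eq_adjoint, ContinuousLinearMap.adjoint_inner_left]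

/-- An operator commuting with an irreducible representation is injective or zero. -/
theorem IsIrreducibleRep.ker_eq_bot_or_eq_zero (hσ : IsIrreducibleRep σ) {T : E →L[ℂ] E}
    (hT : ∀ a, Commute T (σ a)) : LinearMap.ker T.toLinearMap = ⊥ ∨ T = 0 := by
  refine (hσ.2 (LinearMap.ker T.toLinearMap) T.isClosed_ker fun a x hx => ?_).imp_right fun h => ?_
  · have h := DFunLike.congr_fun (hT a).eq x
    have hx' : T x = 0 := hx
    simpa [hx'] using h
  · ext x
    have : x ∈ LinearMap.ker T.toLinearMap := h ▸ Submodule.mem_top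
    simpa using this

/-- Schur's lemma for selfadjoint operators. -/
theorem IsIrreducibleRep.eq_smul_one_of_isSelfAdjoint (hσ : IsIrreducibleRep σ) {T : E →L[ℂ] E}
    (hsa : IsSelfAdjoint T) (hT : ∀ a, Commute T (σ a)) : ∃ c : ℂ, T = c • 1 := by
  have hcomm : ∀ (f : ℝ → ℝ) (a : A), Commute (cfc f T) (σ a) := fun f a =>
    Commute.cfc (hT a) (by rw [hsa.star_eq]; exact hT a) f
  by_cases hsub : (spectrum ℝ T).Subsingleton
  · rcases hsub.eq_empty_or_singleton with h | ⟨c, h⟩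
    · refine ⟨0, ?_⟩
      rw [← cfc_id ℝ T, zero_smul, ← cfc_zero ℝ T]
      exact cfc_congr (by simp [h])
    · refine ⟨c, ?_⟩
      conv_lhs => rw [← cfc_id ℝ T]
      rw [cfc_congr (g := fun _ => c) (by simp [h]), cfc_const c T,
        Algebra.algebraMap_eq_smul_one, Complex.coe_smul]
  · exfalso
    -- Spectral points `s < t` give two functions living on opposite sides of their midpoint.
    -- Applied to `T`, they are nonzero operators with product zero, and the first commutes with
    -- `σ`, so it is injective or zero; injectivity would kill the second.
    have key : ∀ s ∈ spectrum ℝ T, ∀ t ∈ spectrum ℝ T, ¬ s < t := by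
      intro s hs t ht hst
      have hne : ∀ f : ℝ → ℝ, Continuous f → ∀ r ∈ spectrum ℝ T, f r ≠ 0 → cfc f T ≠ 0 :=
        fun f hf r hr hfr h => hfr <|
          (cfc_eq_cfc_iff_eqOn (R := ℝ) (a := T) (f := f) (g := 0) hsa hf.continuousOn
            continuous_zero.continuousOn).1 (by rw [h, cfc_zero]) hr
      have hf : Continuous fun r : ℝ => max (r - (s + t) / 2) 0 := by fun_prop
      have hg : Continuous fun r : ℝ => max ((s + t) / 2 - r) 0 := by fun_prop
      have hfT := hne _ hf t ht (by simp only [ne_eq, max_eq_right_iff, not_le]; linarith)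
      have hgT := hne _ hg s hs (by simp only [ne_eq, max_eq_right_iff, not_le]; linarith)
      have hfg : cfc (fun r : ℝ => max (r - (s + t) / 2) 0) T *
          cfc (fun r : ℝ => max ((s + t) / 2 - r) 0) T = 0 := by
        rw [← cfc_mul _ _ T hf.continuousOn hg.continuousOn, ← cfc_zero ℝ T]
        refine cfc_congr fun r _ => ?_
        rcases le_total r ((s + t) / 2) with h | h
        · simp [max_eq_right (sub_nonpos.2 h)]
        · simp [max_eq_right (sub_nonpos.2 h)]
      rcases hσ.ker_eq_bot_or_eq_zero (hcomm _) with h | h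
      · refine hgT (ContinuousLinearMap.ext fun x => LinearMap.ker_eq_bot.1 h ?_)
        simpa using DFunLike.congr_fun hfg x
      · exact hfT h
    exact hsub fun s hs t ht =>
      le_antisymm (not_lt.1 (key t ht s hs)) (not_lt.1 (key s hs t ht))

/-- Schur's lemma: the commutant of an irreducible representation consists of the scalars. -/
theorem IsIrreducibleRep.eq_smul_one (hσ : IsIrreducibleRep σ) {T : E →L[ℂ] E}
    (hT : ∀ a, Commute T (σ a)) : ∃ c : ℂ, T = c • 1 := by
  have hT' : ∀ a, Commute (star T) (σ a) := fun a => by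
    have h := (hT (star a)).star_star
    rwa [← map_star, star_star] at h
  obtain ⟨c, hc⟩ := hσ.eq_smul_one_of_isSelfAdjoint (T := T + star T) (IsSelfAdjoint.add_star_self T)
    fun a => (hT a).add_left (hT' a)
  obtain ⟨d, hd⟩ := hσ.eq_smul_one_of_isSelfAdjoint (T := Complex.I • (T - star T))
    (by
      rw [IsSelfAdjoint, star_smul, star_sub, star_star, Complex.star_def, Complex.conj_I, neg_smul,
        ← smul_neg, neg_sub])
    fun a => ((hT a).sub_left (hT' a)).smul_left _
  -- `T` is recovered from the two self-adjoint operators as `½ ((T + T*) - i · i (T - T*))`.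
  refine ⟨(2 : ℂ)⁻¹ * (c - Complex.I * d), ?_⟩
  rw [mul_smul, sub_smul, mul_smul, ← hc, ← hd, smul_smul, Complex.I_mul_I, neg_one_smul,
    sub_neg_eq_add, add_add_sub_cancel, ← two_smul ℂ T, smul_smul, inv_mul_cancel₀ two_ne_zero,
    one_smul]

/-- A nonzero intertwiner of irreducible representations is a multiple of a unitary. -/
theorem IsIrreducibleRep.equivalentReps (hσ : IsIrreducibleRep σ) (hτ : IsIrreducibleRep τ)
    {S : E →L[ℂ] F} (hS : ∀ a x, S (σ a x) = τ a (S x)) (hS0 : S ≠ 0) : EquivalentReps σ τ := by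
  have hadj : ∀ a y, S.adjoint (τ a y) = σ a (S.adjoint y) := fun a y => by
    refine ext_inner_left ℂ fun x => ?_
    rw [ContinuousLinearMap.adjoint_inner_right, ← inner_star_rep, ← inner_star_rep,
      ContinuousLinearMap.adjoint_inner_right, hS]
  obtain ⟨c, hc⟩ := hσ.eq_smul_one (T := S.adjoint ∘L S) fun a => by
    ext x
    simp [hS, hadj]
  have hinner : ∀ x, (‖S x‖ : ℂ) ^ 2 = c * (‖x‖ : ℂ) ^ 2 := fun x => by
    have h := DFunLike.congr_fun hc x
    have h2 : inner ℂ x ((S.adjoint ∘L S) x) = inner ℂ (S x) (S x) := by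
      rw [ContinuousLinearMap.comp_apply, ContinuousLinearMap.adjoint_inner_right]
    rw [h, smul_apply, one_apply_eq_self, inner_smul_right, inner_self_eq_norm_sq_to_K,
      inner_self_eq_norm_sq_to_K] at h2
    exact h2.symm
  obtain ⟨x₀, hx₀⟩ : ∃ x, S x ≠ 0 := by
    by_contra! h
    exact hS0 (ContinuousLinearMap.ext h)
  have hx₀' : x₀ ≠ 0 := fun h => hx₀ (by rw [h, map_zero])
  -- `S* S = c` makes `S` scale all norms by the same factor, which is read off at `x₀`; dividing by
  -- it leaves an isometry.
  set r : ℝ := ‖S x₀‖ / ‖x₀‖ with hr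
  have hr0 : 0 < r := div_pos (norm_pos_iff.2 hx₀) (norm_pos_iff.2 hx₀')
  have hcr : c = (r : ℂ) ^ 2 := by
    have : (‖x₀‖ : ℂ) ≠ 0 := by exact_mod_cast (norm_pos_iff.2 hx₀').ne'
    rw [hr]
    push_cast
    rw [div_pow, hinner x₀, mul_div_cancel_right₀ _ (pow_ne_zero 2 this)]
  have hnorm : ∀ x, ‖S x‖ = r * ‖x‖ := fun x => by
    have h := hinner x
    rw [hcr, ← mul_pow] at h
    have h' : ‖S x‖ ^ 2 = (r * ‖x‖) ^ 2 := by exact_mod_cast h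
    exact (pow_left_inj₀ (norm_nonneg _) (by positivity) two_ne_zero).1 h'
  let W : E →ₗᵢ[ℂ] F :=
    { ((r⁻¹ : ℂ) • S).toLinearMap with
      norm_map' := fun x => by
        simp [norm_smul, hnorm, abs_of_pos hr0, hr0.ne'] }
  have hW : ∀ x, W x = (r⁻¹ : ℂ) • S x := fun x => rfl
  have hWσ : ∀ a x, W (σ a x) = τ a (W x) := fun a x => by simp [hW, hS]
  -- The range of an isometry from a complete space is closed; it is invariant and nonzero, so
  -- irreducibility of `τ` makes it everything.
  have hsurj : Function.Surjective W := by
    rcases hτ.2 (LinearMap.range W.toLinearMap) W.isometry.isClosedEmbedding.isClosed_range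
      (by rintro a _ ⟨x, rfl⟩; exact ⟨σ a x, hWσ a x⟩) with h | h
    · exfalso
      have : W x₀ ∈ LinearMap.range W.toLinearMap := ⟨x₀, rfl⟩
      rw [h, Submodule.mem_bot] at this
      exact hx₀' (W.injective (by rw [this, map_zero]))
    · exact LinearMap.range_eq_top.1 h
  exact ⟨LinearIsometryEquiv.ofSurjective W hsurj, hWσ⟩

end Schur

/-- An operator having `v` as an eigenvector, along with its adjoint, commutes with the rank one
operator of `v`. -/
theorem commute_rankOne {H : Type*} [NormedAddCommGroup H] [InnerProductSpace ℂ H]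
    [CompleteSpace H] {T : H →L[ℂ] H} {v : H} {c d : ℂ} (hc : T v = c • v)
    (hd : star T v = d • v) : Commute T (rankOne ℂ v v) := by
  have hz : ∀ z, inner ℂ v (T z) = (starRingEnd ℂ) d * inner ℂ v z := fun z => by
    rw [← ContinuousLinearMap.adjoint_inner_left, ← ContinuousLinearMap.star_eq_adjoint, hd,
      inner_smul_left]
  -- For `v ≠ 0` the two eigenvalues are conjugate, as `⟪v, T v⟫` shows.
  have hcd : c • v = (starRingEnd ℂ) d • v := by
    by_cases hv : v = 0
    · simp [hv]
    · have h1 := hz v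
      rw [hc, inner_smul_right] at h1
      rw [mul_right_cancel₀ (inner_self_ne_zero.2 hv) h1]
  ext z
  rw [mul_apply_eq_comp, mul_apply_eq_comp, InnerProductSpace.rankOne_apply,
    InnerProductSpace.rankOne_apply, map_smul, hc, hz, hcd, smul_smul, mul_comm]

/-! ### Atomic decompositions, minimal projections and the diagonal subspace -/

section Decomposition

variable {A : Type*} [CStarAlgebra A]
  {H : Type*} [NormedAddCommGroup H] [InnerProductSpace ℂ H] [CompleteSpace H]
  {ι : Type*} {E : ι → Type*} [∀ i, NormedAddCommGroup (E i)] [∀ i, InnerProductSpace ℂ (E i)]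
  [∀ i, CompleteSpace (E i)]

/-- The isometries `V i : E i → H` decompose the representation `π` into the pairwise inequivalent
irreducible representations `σ i`. -/
structure IsAtomicDecomposition (π : A →⋆ₐ[ℂ] (H →L[ℂ] H)) (σ : ∀ i, A →⋆ₐ[ℂ] (E i →L[ℂ] E i))
    (V : ∀ i, E i →ₗᵢ[ℂ] H) : Prop where
  irreducible : ∀ i, IsIrreducibleRep (σ i)
  inequivalent : ∀ i j, i ≠ j → ¬ EquivalentReps (σ i) (σ j)
  orthogonal : OrthogonalFamily ℂ E V
  total : ∀ z : H, (∀ i x, inner ℂ (V i x) z = 0) → z = 0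
  intertwine : ∀ i a x, π a (V i x) = V i (σ i a x)

theorem IsAtomicRep.exists_decomposition.{u, v} {A : Type v} [CStarAlgebra A] {H : Type u}
    [NormedAddCommGroup H] [InnerProductSpace ℂ H] [CompleteSpace H]
    {π : A →⋆ₐ[ℂ] (H →L[ℂ] H)} (h : IsAtomicRep π) :
    ∃ (ι : Type u) (E : ι → Type u)
      (_ : ∀ i, NormedAddCommGroup (E i)) (_ : ∀ i, InnerProductSpace ℂ (E i))
      (_ : ∀ i, CompleteSpace (E i)) (σ : ∀ i, A →⋆ₐ[ℂ] (E i →L[ℂ] E i))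
      (V : ∀ i, E i →ₗᵢ[ℂ] H), IsAtomicDecomposition π σ V := by
  classical
  obtain ⟨ι, E, _, _, _, σ, hirr, hineq, U, hU⟩ := h
  let V : ∀ i, E i →ₗᵢ[ℂ] H := fun i => U.symm.toLinearIsometry.comp
    { lp.lsingle (𝕜 := ℂ) (E := E) 2 i with
      norm_map' := fun x => lp.norm_single (E := E) (p := 2) (by norm_num) i x }
  have hV : ∀ i x, V i x = U.symm (lp.single 2 i x) := fun i x => rfl
  have hUV : ∀ i x, U (V i x) = lp.single 2 i x := fun i x => by
    rw [hV, LinearIsometryEquiv.apply_symm_apply]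
  have hinner : ∀ i x z, inner ℂ (V i x) z = inner ℂ x (U z i) := fun i x z => by
    rw [← lp.inner_single_left, ← hUV, LinearIsometryEquiv.inner_map_map]
  refine ⟨ι, E, _, _, _, σ, V, hirr, hineq, ?_, ?_, ?_⟩
  · intro i j hij x y
    rw [hinner, hUV, lp.single_apply_ne _ _ _ hij, inner_zero_right]
  · intro z hz
    refine (map_eq_zero_iff U U.injective).1 (lp.ext (funext fun i => ?_))
    exact ext_inner_left ℂ fun x => by rw [← hinner, hz]; simp
  · intro i a x
    refine U.injective (lp.ext (funext fun j => ?_))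
    rw [hU, hUV, hUV]
    by_cases hij : j = i
    · subst hij
      rw [lp.single_apply_self, lp.single_apply_self]
    · rw [lp.single_apply_ne _ _ _ hij, lp.single_apply_ne _ _ _ hij, map_zero]

theorem IsAtomicDecomposition.isAtomicRep.{u, v} {A : Type v} [CStarAlgebra A] {H : Type u}
    [NormedAddCommGroup H] [InnerProductSpace ℂ H] [CompleteSpace H]
    {ι : Type u} {E : ι → Type u} [∀ i, NormedAddCommGroup (E i)]
    [∀ i, InnerProductSpace ℂ (E i)] [∀ i, CompleteSpace (E i)]
    {π : A →⋆ₐ[ℂ] (H →L[ℂ] H)} {σ : ∀ i, A →⋆ₐ[ℂ] (E i →L[ℂ] E i)} {V : ∀ i, E i →ₗᵢ[ℂ] H}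
    (h : IsAtomicDecomposition π σ V) : IsAtomicRep π := by
  classical
  have hV : IsHilbertSum ℂ E V := by
    refine IsHilbertSum.mk h.orthogonal (top_le_iff.2 ?_)
    rw [Submodule.topologicalClosure_eq_top_iff, Submodule.eq_bot_iff]
    intro z hz
    exact h.total z fun i x => (Submodule.mem_orthogonal _ _).1 hz _
      (Submodule.mem_iSup_of_mem i ⟨x, rfl⟩)
  refine ⟨ι, E, _, _, _, σ, h.irreducible, h.inequivalent, hV.linearIsometryEquiv, ?_⟩
  have hinner : ∀ i x z, inner ℂ x (hV.linearIsometryEquiv z i) = inner ℂ (V i x) z :=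
    fun i x z => by
      rw [← lp.inner_single_left, ← hV.linearIsometryEquiv_symm_apply_single,
        ← LinearIsometryEquiv.inner_map_map hV.linearIsometryEquiv.symm,
        LinearIsometryEquiv.symm_apply_apply]
  intro a x i
  refine ext_inner_left ℂ fun y => ?_
  rw [hinner, ← inner_star_rep, h.intertwine, ← hinner, inner_star_rep]

namespace IsAtomicDecomposition

variable {π : A →⋆ₐ[ℂ] (H →L[ℂ] H)} {σ : ∀ i, A →⋆ₐ[ℂ] (E i →L[ℂ] E i)}
  {V : ∀ i, E i →ₗᵢ[ℂ] H}

theorem adjoint_apply (h : IsAtomicDecomposition π σ V) (i : ι) (a : A) (z : H) :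
    (V i).toContinuousLinearMap.adjoint (π a z) =
      σ i a ((V i).toContinuousLinearMap.adjoint z) := by
  refine ext_inner_left ℂ fun x => ?_
  rw [ContinuousLinearMap.adjoint_inner_right, ← inner_star_rep, ← inner_star_rep,
    ContinuousLinearMap.adjoint_inner_right, LinearIsometry.coe_toContinuousLinearMap,
    h.intertwine]

/-- An operator in the commutant acts on each summand by a scalar. -/
theorem exists_smul_of_mem_centralizer (h : IsAtomicDecomposition π σ V) {T : H →L[ℂ] H}
    (hT : T ∈ Set.centralizer (Set.range π)) (i : ι) : ∃ c : ℂ, ∀ x, T (V i x) = c • V i x := by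
  have hcomm : ∀ a z, T (π a z) = π a (T z) := fun a z =>
    (DFunLike.congr_fun (hT (π a) ⟨a, rfl⟩) z).symm
  let S : ∀ j, E i →L[ℂ] E j := fun j =>
    (V j).toContinuousLinearMap.adjoint ∘L T ∘L (V i).toContinuousLinearMap
  -- The block of `T` from summand `i` to summand `j` is an intertwiner: a scalar for `j = i`, and
  -- zero otherwise by inequivalence.
  have hS : ∀ j a x, S j (σ i a x) = σ j a (S j x) := fun j a x => by
    simp only [S, ContinuousLinearMap.comp_apply, LinearIsometry.coe_toContinuousLinearMap]
    rw [← h.intertwine, hcomm, h.adjoint_apply]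
  obtain ⟨c, hc⟩ := (h.irreducible i).eq_smul_one (T := S i) fun a =>
    ContinuousLinearMap.ext fun x => hS i a x
  refine ⟨c, fun x => sub_eq_zero.1 (h.total _ fun j y => ?_)⟩
  have hin : inner ℂ (V j y) (T (V i x)) = inner ℂ y (S j x) := by
    simp only [S, ContinuousLinearMap.comp_apply]
    rw [ContinuousLinearMap.adjoint_inner_right, LinearIsometry.coe_toContinuousLinearMap,
      LinearIsometry.coe_toContinuousLinearMap]
  rw [inner_sub_right, hin]
  by_cases hij : j = i
  · subst hij
    rw [hc, smul_apply, one_apply_eq_self, inner_smul_right, inner_smul_right,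
      LinearIsometry.inner_map_map, sub_self]
  · have : S j = 0 := by
      by_contra hne
      exact h.inequivalent i j (Ne.symm hij)
        ((h.irreducible i).equivalentReps (h.irreducible j) (hS j) hne)
    rw [this, inner_smul_right, h.orthogonal hij y x]
    simp

theorem star_mem_centralizer {T : H →L[ℂ] H} (hT : T ∈ Set.centralizer (Set.range π)) :
    star T ∈ Set.centralizer (Set.range π) := by
  rintro _ ⟨a, rfl⟩
  have := congrArg star (hT (π (star a)) ⟨_, rfl⟩)
  simpa [← map_star] using this.symm

/-- The commutant is closed under adjoints, so each of its elements has `V i x` as an eigenvector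
together with its adjoint, and hence commutes with the rank one operator. -/
theorem rankOne_mem_envelopingAlgebra (h : IsAtomicDecomposition π σ V) (i : ι) (x : E i) :
    rankOne ℂ (V i x) (V i x) ∈ envelopingAlgebra π := by
  intro T hT
  obtain ⟨c, hc⟩ := h.exists_smul_of_mem_centralizer hT i
  obtain ⟨d, hd⟩ := h.exists_smul_of_mem_centralizer (star_mem_centralizer hT) i
  exact commute_rankOne (hc x) (hd x)

theorem isMinimalProjection_rankOne (h : IsAtomicDecomposition π σ V) {i : ι} {x : E i}
    (hx : ‖x‖ = 1) :
    IsMinimalProjection (envelopingAlgebra π) (rankOne ℂ (V i x) (V i x)) := by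
  have hv : ‖V i x‖ = 1 := by rw [LinearIsometry.norm_map, hx]
  have hp := InnerProductSpace.isStarProjection_rankOne_self (𝕜 := ℂ) hv
  have hv0 : V i x ≠ 0 := fun h0 => by simp [h0] at hv
  refine ⟨h.rankOne_mem_envelopingAlgebra i x, hp, InnerProductSpace.rankOne_ne_zero hv0 hv0, ?_⟩
  intro q _ hq hle
  have hpq : rankOne ℂ (V i x) (V i x) * q = q := ((hq.le_tfae hp).out 0 1).1 hle
  have hqp : q * rankOne ℂ (V i x) (V i x) = q := ((hq.le_tfae hp).out 0 2).1 hle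
  -- A projection `q` below the rank one `p` equals `p q p`, a multiple of `p`; idempotency then
  -- leaves only the factors `0` and `1`.
  have hqc : q = inner ℂ (V i x) (q (V i x)) • rankOne ℂ (V i x) (V i x) := by
    ext z
    conv_lhs => rw [← hpq, ← hqp]
    simp [smul_smul, mul_comm]
  set c := inner ℂ (V i x) (q (V i x))
  have hcc : (c * c - c) • rankOne ℂ (V i x) (V i x) = 0 := by
    have hqq := hq.isIdempotentElem.eq
    rw [hqc, smul_mul_smul_comm, hp.isIdempotentElem.eq] at hqq
    rw [sub_smul, hqq, sub_self]
  rcases smul_eq_zero.1 hcc with h0 | h0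
  · have : c * (c - 1) = 0 := by rw [← h0]; ring
    rcases mul_eq_zero.1 this with hc | hc
    · left; rw [hqc, hc, zero_smul]
    · right; rw [hqc, sub_eq_zero.1 hc, one_smul]
  · exact absurd h0 (InnerProductSpace.rankOne_ne_zero hv0 hv0)

/-- The projections `V i (V i)*` onto the summands lie in the commutant, so `p` commutes with them
and preserves summands. It therefore fixes a unit vector in some summand, and by minimality equals
the rank one projection onto its line. -/
theorem exists_eq_rankOne (h : IsAtomicDecomposition π σ V) {p : H →L[ℂ] H}
    (hp : IsMinimalProjection (envelopingAlgebra π) p) :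
    ∃ (i : ι) (x : E i), ‖x‖ = 1 ∧ p = rankOne ℂ (V i x) (V i x) := by
  obtain ⟨hpN, hproj, hp0, hmin⟩ := hp
  have hadj : ∀ i (x : E i), (V i).toContinuousLinearMap.adjoint (V i x) = x := fun i x =>
    ext_inner_left ℂ fun y => by
      rw [ContinuousLinearMap.adjoint_inner_right, LinearIsometry.coe_toContinuousLinearMap,
        LinearIsometry.inner_map_map]
  have hR : ∀ i, (V i).toContinuousLinearMap ∘L (V i).toContinuousLinearMap.adjoint ∈
      Set.centralizer (Set.range π) := by
    rintro i _ ⟨a, rfl⟩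
    ext z
    simp only [mul_apply_eq_comp, ContinuousLinearMap.comp_apply,
      LinearIsometry.coe_toContinuousLinearMap, h.adjoint_apply, h.intertwine]
  obtain ⟨i, x, hx⟩ : ∃ i x, p (V i x) ≠ 0 := by
    by_contra! hall
    refine hp0 (ContinuousLinearMap.ext fun z => h.total _ fun i x => ?_)
    rw [← hproj.isSelfAdjoint.star_eq, ContinuousLinearMap.star_eq_adjoint,
      ContinuousLinearMap.adjoint_inner_right, hall, inner_zero_left]
  set y := (V i).toContinuousLinearMap.adjoint (p (V i x)) with hy
  have hVy : V i y = p (V i x) := by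
    have := DFunLike.congr_fun (hpN _ (hR i)) (V i x)
    simpa [hadj] using this
  have hy0 : y ≠ 0 := fun h0 => hx (by rw [← hVy, h0, map_zero])
  have hpV : p (V i y) = V i y := by
    rw [hVy, ← mul_apply_eq_comp, hproj.isIdempotentElem.eq]
  refine ⟨i, (‖y‖⁻¹ : ℂ) • y, by simp [norm_smul, hy0], ?_⟩
  have hu : ‖(‖y‖⁻¹ : ℂ) • y‖ = 1 := by simp [norm_smul, hy0]
  have hq := h.isMinimalProjection_rankOne hu
  refine ((hmin _ hq.1 hq.2.1 ?_).resolve_left hq.2.2.1).symm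
  refine ((hq.2.1.le_tfae hproj).out 0 1).2 ?_
  ext z
  simp [hpV]

/-- The diagonal subspace is the closed span of the symmetric elementary tensors of vectors in the
irreducible summands. -/
theorem diagonalSubspace_eq (h : IsAtomicDecomposition π σ V) :
    diagonalSubspace π = (Submodule.span ℂ
      {w | ∃ (i : ι) (x : E i), w = htmul (V i x) (V i x)}).topologicalClosure := by
  rw [diagonalSubspace]
  congr 1
  refine le_antisymm (iSup_le ?_) (Submodule.span_le.2 ?_)
  · rintro ⟨p, hp⟩
    obtain ⟨i, x, -, rfl⟩ := h.exists_eq_rankOne hp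
    rintro _ ⟨z, rfl⟩
    simp only [opTensor_rankOne, ContinuousLinearMap.coe_coe, InnerProductSpace.rankOne_apply]
    exact Submodule.smul_mem _ _ (Submodule.subset_span ⟨i, x, rfl⟩)
  · rintro _ ⟨i, x, rfl⟩
    by_cases hx : x = 0
    · simp [hx, zero_htmul]
    have hu : ‖(‖x‖⁻¹ : ℂ) • x‖ = 1 := by simp [norm_smul, hx]
    refine Submodule.mem_iSup_of_mem ⟨_, h.isMinimalProjection_rankOne (i := i) hu⟩
      ⟨htmul (V i x) (V i x), ?_⟩
    have hn : (‖x‖ : ℂ) ≠ 0 := by exact_mod_cast (norm_pos_iff.2 hx).ne'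
    have hv : rankOne ℂ (V i ((‖x‖⁻¹ : ℂ) • x)) (V i ((‖x‖⁻¹ : ℂ) • x)) (V i x) = V i x := by
      rw [InnerProductSpace.rankOne_apply, LinearIsometry.inner_map_map, inner_smul_left,
        inner_self_eq_norm_sq_to_K, map_smul, smul_smul]
      simp only [map_inv₀, Complex.conj_ofReal, Complex.coe_algebraMap]
      rw [show ((‖x‖ : ℂ)⁻¹ * (‖x‖ : ℂ) ^ 2) * (‖x‖ : ℂ)⁻¹ = 1 by field_simp, one_smul]
    rw [ContinuousLinearMap.coe_coe, opTensor_htmul, hv]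

theorem htmul_mem_diagonalSubspace (h : IsAtomicDecomposition π σ V) (i : ι) (x : E i) :
    htmul (V i x) (V i x) ∈ diagonalSubspace π := by
  rw [h.diagonalSubspace_eq]
  exact Submodule.le_topologicalClosure _ (Submodule.subset_span ⟨i, x, rfl⟩)

theorem mem_diagonalSubspace_orthogonal (h : IsAtomicDecomposition π σ V)
    {z : HilbertTensor H H} (hz : ∀ i x, inner ℂ (htmul (V i x) (V i x)) z = 0) :
    z ∈ (diagonalSubspace π)ᗮ := by
  rw [h.diagonalSubspace_eq, Submodule.orthogonal_closure, Submodule.mem_orthogonal]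
  intro u hu
  induction hu using Submodule.span_induction with
  | mem u hu => obtain ⟨i, x, rfl⟩ := hu; exact hz i x
  | zero => exact inner_zero_left _
  | add u v _ _ hu hv => rw [inner_add_left, hu, hv, add_zero]
  | smul c u _ hu => rw [inner_smul_left, hu, mul_zero]

theorem mul_diagonalProjection_eq_zero (h : IsAtomicDecomposition π σ V)
    {T : HilbertTensor H H →L[ℂ] HilbertTensor H H}
    (hT : ∀ i x, T (htmul (V i x) (V i x)) = 0) : T * diagonalProjection π = 0 := by
  have hle : diagonalSubspace π ≤ LinearMap.ker T.toLinearMap := by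
    rw [h.diagonalSubspace_eq]
    refine Submodule.topologicalClosure_minimal _ (Submodule.span_le.2 ?_) T.isClosed_ker
    rintro _ ⟨i, x, rfl⟩
    exact hT i x
  ext z
  exact hle (Submodule.starProjection_apply_mem _ z)

end IsAtomicDecomposition

end Decomposition

/-! ### Matrix coefficients of the operators in the triangle inequality -/

section TriangleOperators

variable {H : Type*} [NormedAddCommGroup H] [InnerProductSpace ℂ H]

theorem hassoc_symm_htmul (x y z : H) :
    (hassoc H H H).symm (htmul x (htmul y z)) = htmul (htmul x y) z := by
  rw [LinearIsometryEquiv.symm_apply_eq, hassoc_htmul]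

theorem hrightComm_symm_htmul (x y z : H) :
    (hrightComm H H H).symm (htmul (htmul x y) z) = htmul (htmul x z) y := by
  rw [LinearIsometryEquiv.symm_apply_eq, hrightComm_htmul]

theorem hcomm_symm_htmul (x y : H) : (hcomm H H).symm (htmul x y) = htmul y x := by
  rw [LinearIsometryEquiv.symm_apply_eq, hcomm_htmul]

variable (T : HilbertTensor H H →L[ℂ] HilbertTensor H H)

theorem tensorOne_htmul (x y z : H) :
    tensorOne T (htmul (htmul x y) z) = htmul (T (htmul x y)) z := by
  simp [tensorOne, opTensor_htmul]

theorem oneTensor_htmul (x y z : H) : oneTensor T (htmul (htmul x y) z) =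
    (hassoc H H H).symm (htmul x (T (htmul y z))) := by
  simp [oneTensor, LinearIsometryEquiv.conjStarAlgEquiv_apply, hassoc_htmul, opTensor_htmul]

theorem flip_htmul (x y : H) : flip T (htmul x y) = hcomm H H (T (htmul y x)) := by
  simp [flip, LinearIsometryEquiv.conjStarAlgEquiv_apply, hcomm_symm_htmul]

theorem midOne_htmul (x y z : H) : midOne T (htmul (htmul x y) z) =
    hrightComm H H H (htmul (T (htmul x z)) y) := by
  simp [midOne, LinearIsometryEquiv.conjStarAlgEquiv_apply, hrightComm_symm_htmul,
    tensorOne_htmul]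

theorem inner_oneTensor (x y z x' y' z' : H) :
    inner ℂ (htmul (htmul x' y') z') (oneTensor T (htmul (htmul x y) z)) =
      inner ℂ x' x * inner ℂ (htmul y' z') (T (htmul y z)) := by
  rw [oneTensor_htmul, ← hassoc_symm_htmul, LinearIsometryEquiv.inner_map_map, inner_htmul]

theorem inner_midOne (x y z x' y' z' : H) :
    inner ℂ (htmul (htmul x' y') z') (midOne T (htmul (htmul x y) z)) =
      inner ℂ (htmul x' z') (T (htmul x z)) * inner ℂ y' y := by
  rw [midOne_htmul, ← hrightComm_htmul x' z' y', LinearIsometryEquiv.inner_map_map, inner_htmul]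

end TriangleOperators

/-! ### Irreducible summands are one-dimensional -/

section OneDimensional

variable {A : Type*} [CStarAlgebra A]
  {H : Type*} [NormedAddCommGroup H] [InnerProductSpace ℂ H] [CompleteSpace H]
  {ι : Type*} {E : ι → Type*} [∀ i, NormedAddCommGroup (E i)] [∀ i, InnerProductSpace ℂ (E i)]
  [∀ i, CompleteSpace (E i)]
  {π : A →⋆ₐ[ℂ] (H →L[ℂ] H)} {ρ : HilbertTensor H H →L[ℂ] HilbertTensor H H}
  {σ : ∀ i, A →⋆ₐ[ℂ] (E i →L[ℂ] E i)} {V : ∀ i, E i →ₗᵢ[ℂ] H}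

namespace IsCompactQuantumMetricSpace

theorem inner_left_eq_inner_right (h : IsCompactQuantumMetricSpace π ρ) (x y : HilbertTensor H H) :
    inner ℂ (ρ x) y = inner ℂ x (ρ y) :=
  ((ContinuousLinearMap.nonneg_iff_isPositive ρ).1 h.nonneg).inner_left_eq_inner_right x y

theorem apply_of_mem_diagonalSubspace (h : IsCompactQuantumMetricSpace π ρ)
    {z : HilbertTensor H H} (hz : z ∈ diagonalSubspace π) : ρ z = 0 := by
  have := DFunLike.congr_fun h.mul_diagonal z
  rwa [mul_apply_eq_comp, diagonalProjection, Submodule.starProjection_eq_self_iff.2 hz] at this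

/-- Polarization of the vanishing of `ρ` on the tensors `z ⊗ z`. -/
theorem apply_htmul_add_htmul (h : IsCompactQuantumMetricSpace π ρ)
    (hd : IsAtomicDecomposition π σ V) (i : ι) (x y : E i) :
    ρ (htmul (V i x) (V i y)) + ρ (htmul (V i y) (V i x)) = 0 := by
  have h0 : ∀ z, ρ (htmul (V i z) (V i z)) = 0 := fun z =>
    h.apply_of_mem_diagonalSubspace (hd.htmul_mem_diagonalSubspace i z)
  have h1 := h0 (x + y)
  rw [add_comm]
  simpa [add_htmul, htmul_add, h0] using h1

/-- The triangle inequality forces a quantum metric to vanish on the tensor square of every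
irreducible summand. -/
theorem apply_htmul_eq_zero (h : IsCompactQuantumMetricSpace π ρ)
    (hd : IsAtomicDecomposition π σ V) (i : ι) (x y : E i) :
    ρ (htmul (V i x) (V i y)) = 0 := by
  by_cases hx : x = 0
  · simp [hx, zero_htmul]
  set v := V i x
  set u := V i y
  have hv : inner ℂ v v ≠ 0 := inner_self_ne_zero.2 fun h0 =>
    hx ((V i).injective (by rw [map_zero]; exact h0))
  have hvv : ρ (htmul v v) = 0 :=
    h.apply_of_mem_diagonalSubspace (hd.htmul_mem_diagonalSubspace i x)
  have hvu : ρ (htmul v u) = -ρ (htmul u v) :=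
    eq_neg_of_add_eq_zero_left (h.apply_htmul_add_htmul hd i x y)
  -- At `v ⊗ v ⊗ u` the first term vanishes and the other two have equal quadratic forms, so the
  -- positive difference annihilates this vector.
  have hD : (tensorOne ρ + oneTensor ρ - midOne ρ) (htmul (htmul v v) u) = 0 := by
    refine apply_eq_zero_of_inner_eq_zero (sub_nonneg.2 h.triangle) ?_
    rw [sub_apply, add_apply, inner_sub_right, inner_add_right, inner_oneTensor, inner_midOne,
      tensorOne_htmul, hvv, zero_htmul, inner_zero_right, zero_add, mul_comm, sub_self]
  -- Against `v ⊗ u ⊗ v` only `⟪v, v⟫ ⟪u ⊗ v, ρ (v ⊗ u)⟫` survives. Antisymmetry turns its vanishing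
  -- into that of the quadratic form of `ρ` at `v ⊗ u`.
  have hw := congrArg (inner ℂ (htmul (htmul v u) v)) hD
  rw [sub_apply, add_apply, inner_sub_right, inner_add_right, inner_oneTensor, inner_midOne,
    tensorOne_htmul, hvv, zero_htmul, inner_zero_right, zero_add,
    ← h.inner_left_eq_inner_right (htmul v v), hvv, inner_zero_left, zero_mul, sub_zero] at hw
  refine apply_eq_zero_of_inner_eq_zero h.nonneg ?_
  rw [← h.inner_left_eq_inner_right, hvu, inner_neg_left, h.inner_left_eq_inner_right,
    (mul_eq_zero.1 hw).resolve_left hv, neg_zero]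

/-- This is the form in which `dim (E i) ≤ 1` is used: for `x ≠ 0` it makes every `y` a multiple of
`x`. It holds because the antisymmetric tensor of `x` and `y` is orthogonal to the diagonal subspace
and killed by `ρ`, hence zero. -/
theorem inner_smul_eq_inner_smul (h : IsCompactQuantumMetricSpace π ρ)
    (hd : IsAtomicDecomposition π σ V) (i : ι) (x y : E i) :
    inner ℂ x x • y = inner ℂ x y • x := by
  have hz : htmul (V i x) (V i y) - htmul (V i y) (V i x) = 0 := by
    refine h.eq_zero_of_apply_eq_zero _ (hd.mem_diagonalSubspace_orthogonal fun j z => ?_) ?_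
    · rw [inner_sub_right, inner_htmul, inner_htmul, mul_comm, sub_self]
    · rw [map_sub, h.apply_htmul_eq_zero hd, h.apply_htmul_eq_zero hd, sub_zero]
  refine ext_inner_left ℂ fun g => ?_
  have hg := congrArg (inner ℂ (htmul (V i x) (V i g))) hz
  simp only [inner_sub_right, inner_htmul, LinearIsometry.inner_map_map, inner_zero_right] at hg
  rw [inner_smul_right, inner_smul_right, sub_eq_zero.1 hg]

end IsCompactQuantumMetricSpace

end OneDimensional

/-! ### Diagonalisation of the representation -/

section Diagonal

/-- The scalar operators on a Hilbert space. -/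
def scalarRep (E : Type*) [NormedAddCommGroup E] [InnerProductSpace ℂ E] [CompleteSpace E] :
    ℂ →⋆ₐ[ℂ] (E →L[ℂ] E) where
  toFun c := c • 1
  map_one' := one_smul _ _
  map_mul' c d := by rw [smul_mul_smul_comm, one_mul]
  map_zero' := zero_smul _ _
  map_add' c d := add_smul _ _ _
  commutes' c := (Algebra.algebraMap_eq_smul_one c).symm
  map_star' c := by rw [star_smul, star_one]

/-- The Hilbert basis `b` consists of joint eigenvectors of the representation `π`, with pairwise
distinct eigencharacters `χ i`. -/
structure IsDiagonalBasis {A : Type*} [CStarAlgebra A] {H : Type*} [NormedAddCommGroup H]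
    [InnerProductSpace ℂ H] [CompleteSpace H] {ι : Type*} (π : A →⋆ₐ[ℂ] (H →L[ℂ] H))
    (b : HilbertBasis ι ℂ H) (χ : ι → A → ℂ) : Prop where
  injective : Function.Injective χ
  apply_basis : ∀ i a, π a (b i) = χ i a • b i

theorem IsCompactQuantumMetricSpace.exists_isDiagonalBasis.{u, v} {A : Type v} [CStarAlgebra A]
    {H : Type u} [NormedAddCommGroup H] [InnerProductSpace ℂ H] [CompleteSpace H]
    {π : A →⋆ₐ[ℂ] (H →L[ℂ] H)} {ρ : HilbertTensor H H →L[ℂ] HilbertTensor H H}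
    (h : IsCompactQuantumMetricSpace π ρ) :
    ∃ (ι : Type u) (b : HilbertBasis ι ℂ H) (χ : ι → A → ℂ), IsDiagonalBasis π b χ := by
  classical
  obtain ⟨ι, E, _, _, _, σ, V, hd⟩ := h.atomic.exists_decomposition
  have hunit : ∀ i, ∃ e : E i, ‖e‖ = 1 := fun i =>
    haveI := (hd.irreducible i).1
    exists_norm_eq (E i) zero_le_one
  choose e he using hunit
  have hee : ∀ i, inner ℂ (e i) (e i) = (1 : ℂ) := fun i => by
    rw [inner_self_eq_norm_sq_to_K, he]; simp
  have hspan : ∀ i y, y = inner ℂ (e i) y • e i := fun i y => by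
    have := h.inner_smul_eq_inner_smul hd i (e i) y
    rwa [hee, one_smul] at this
  have hon : Orthonormal ℂ fun i => V i (e i) :=
    ⟨fun i => by rw [LinearIsometry.norm_map, he], fun i j hij => hd.orthogonal hij _ _⟩
  let b : HilbertBasis ι ℂ H := HilbertBasis.mkOfOrthogonalEqBot hon (by
    rw [Submodule.eq_bot_iff]
    intro z hz
    refine hd.total z fun i x => ?_
    rw [hspan i x, map_smul, inner_smul_left,
      (Submodule.mem_orthogonal _ _).1 hz _ (Submodule.subset_span ⟨i, rfl⟩), mul_zero])
  have hb : ∀ i, b i = V i (e i) := fun i => by simp [b]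
  have happ : ∀ i a, π a (b i) = inner ℂ (b i) (π a (b i)) • b i := fun i a => by
    rw [hb, hd.intertwine, LinearIsometry.inner_map_map, ← map_smul, ← hspan]
  refine ⟨ι, b, fun i a => inner ℂ (b i) (π a (b i)), fun i j hij => ?_, happ⟩
  by_contra hne
  -- If the characters of `b i` and `b j` agreed, the operator moving `b i` to `b j` would be in the
  -- commutant, whose elements only scale `b i`.
  have hT : rankOne ℂ (b j) (b i) ∈ Set.centralizer (Set.range π) := by
    rintro _ ⟨a, rfl⟩
    ext z
    have hij' : inner ℂ (b j) (π a (b j)) = inner ℂ (b i) (π a (b i)) := (congrFun hij a).symm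
    have hz : inner ℂ (b i) (π a z) = inner ℂ (b i) (π a (b i)) * inner ℂ (b i) z := by
      rw [← inner_star_rep, happ i (star a), inner_smul_left, inner_conj_symm, inner_star_rep]
    rw [mul_apply_eq_comp, mul_apply_eq_comp, InnerProductSpace.rankOne_apply,
      InnerProductSpace.rankOne_apply, map_smul, happ j, hij', hz, smul_smul, mul_comm]
  obtain ⟨c, hc⟩ := hd.exists_smul_of_mem_centralizer hT i
  have hce := hc (e i)
  have hn : ‖b i‖ = 1 := b.orthonormal.1 i
  rw [← hb, InnerProductSpace.rankOne_apply, inner_self_eq_norm_sq_to_K, hn] at hce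
  have h1 := congrArg (inner ℂ (b j)) hce
  rw [inner_smul_right, inner_smul_right, b.orthonormal.2 (Ne.symm hne),
    inner_self_eq_norm_sq_to_K, b.orthonormal.1 j] at h1
  simp at h1

namespace IsDiagonalBasis

variable {A : Type*} [CStarAlgebra A]
  {H : Type*} [NormedAddCommGroup H] [InnerProductSpace ℂ H] [CompleteSpace H]
  {ι : Type*} {π : A →⋆ₐ[ℂ] (H →L[ℂ] H)} {b : HilbertBasis ι ℂ H} {χ : ι → A → ℂ}

theorem char_eq (h : IsDiagonalBasis π b χ) (i : ι) (a : A) :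
    χ i a = inner ℂ (b i) (π a (b i)) := by
  rw [h.apply_basis, inner_smul_right, inner_self_eq_norm_sq_to_K, b.orthonormal.1 i]
  simp

/-- The eigencharacters as morphisms of star algebras. -/
def char (h : IsDiagonalBasis π b χ) (i : ι) : A →⋆ₐ[ℂ] ℂ where
  toFun := χ i
  map_one' := by
    rw [h.char_eq, map_one, one_apply_eq_self, inner_self_eq_norm_sq_to_K, b.orthonormal.1 i]
    simp
  map_mul' a a' := by
    rw [h.char_eq, map_mul, mul_apply_eq_comp, h.apply_basis i a', map_smul, inner_smul_right,
      ← h.char_eq, mul_comm]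
  map_zero' := by rw [h.char_eq, map_zero]; simp
  map_add' a a' := by
    rw [h.char_eq, map_add, add_apply, inner_add_right, ← h.char_eq, ← h.char_eq]
  commutes' c := by
    rw [h.char_eq, AlgHomClass.commutes, Algebra.algebraMap_eq_smul_one, smul_apply,
      one_apply_eq_self, inner_smul_right, inner_self_eq_norm_sq_to_K, b.orthonormal.1 i]
    simp
  map_star' a := by
    rw [h.char_eq, h.char_eq, Complex.star_def, inner_conj_symm, ← inner_star_rep, star_star]

/-- The one-dimensional representation on the line spanned by a basis vector. -/
def lineRep (h : IsDiagonalBasis π b χ) (i : ι) :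
    A →⋆ₐ[ℂ] (↥(ℂ ∙ b i) →L[ℂ] ↥(ℂ ∙ b i)) :=
  (scalarRep ↥(ℂ ∙ b i)).comp (h.char i)

theorem isAtomicDecomposition (h : IsDiagonalBasis π b χ) :
    IsAtomicDecomposition π h.lineRep fun i => (ℂ ∙ b i).subtypeₗᵢ := by
  have hb0 : ∀ i, b i ≠ 0 := fun i => b.orthonormal.ne_zero i
  refine ⟨fun i => ⟨?_, fun W _ _ => ?_⟩, fun i j hij => ?_, ?_, fun z hz => ?_, ?_⟩
  · exact ⟨⟨b i, Submodule.mem_span_singleton_self _⟩, 0, fun h0 => hb0 i (congrArg Subtype.val h0)⟩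
  · rw [or_iff_not_imp_left]
    intro hW
    obtain ⟨w, hw, hw0⟩ := Submodule.exists_mem_ne_zero_of_ne_bot hW
    rw [eq_top_iff]
    rintro ⟨y, hy⟩ -
    obtain ⟨c, hc⟩ := Submodule.mem_span_singleton.1 w.2
    obtain ⟨d, rfl⟩ := Submodule.mem_span_singleton.1 hy
    have hc0 : c ≠ 0 := by
      rintro rfl
      exact hw0 (Subtype.ext (by rw [← hc]; simp))
    convert W.smul_mem (d * c⁻¹) hw using 1
    refine Subtype.ext ?_
    change d • b i = (d * c⁻¹) • (w : H)
    rw [← hc, smul_smul, mul_assoc, inv_mul_cancel₀ hc0, mul_one]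
  · rintro ⟨U, hU⟩
    -- A unitary intertwining two scalar actions forces the scalars, hence the characters, to agree.
    refine hij (h.injective (funext fun a => ?_))
    let w : ↥(ℂ ∙ b i) := ⟨b i, Submodule.mem_span_singleton_self _⟩
    have hw : U w ≠ 0 := fun h0 => by
      rw [map_eq_zero_iff U U.injective] at h0
      exact hb0 i (congrArg Subtype.val h0)
    have := hU a w
    change U (χ i a • w) = χ j a • U w at this
    rw [map_smul] at this
    exact smul_left_injective ℂ hw this
  · rintro i j hij ⟨x, hx⟩ ⟨y, hy⟩
    obtain ⟨c, rfl⟩ := Submodule.mem_span_singleton.1 hx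
    obtain ⟨d, rfl⟩ := Submodule.mem_span_singleton.1 hy
    change inner ℂ (c • b i) (d • b j) = 0
    rw [inner_smul_left, inner_smul_right, b.orthonormal.2 hij]
    simp
  · exact inner_eq_zero_of_hilbertBasis b fun i =>
      hz i ⟨b i, Submodule.mem_span_singleton_self _⟩
  · rintro i a ⟨x, hx⟩
    obtain ⟨c, rfl⟩ := Submodule.mem_span_singleton.1 hx
    change π a (c • b i) = χ i a • c • b i
    rw [map_smul, h.apply_basis, smul_comm]

theorem htmul_mem_diagonalSubspace (h : IsDiagonalBasis π b χ) (i : ι) :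
    htmul (b i) (b i) ∈ diagonalSubspace π :=
  h.isAtomicDecomposition.htmul_mem_diagonalSubspace i ⟨b i, Submodule.mem_span_singleton_self _⟩

theorem mem_diagonalSubspace_orthogonal (h : IsDiagonalBasis π b χ) {z : HilbertTensor H H}
    (hz : ∀ i, inner ℂ (htmul (b i) (b i)) z = 0) : z ∈ (diagonalSubspace π)ᗮ := by
  refine h.isAtomicDecomposition.mem_diagonalSubspace_orthogonal ?_
  rintro i ⟨x, hx⟩
  obtain ⟨c, rfl⟩ := Submodule.mem_span_singleton.1 hx
  change inner ℂ (htmul (c • b i) (c • b i)) z = 0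
  rw [smul_htmul, htmul_smul, smul_smul, inner_smul_left, hz, mul_zero]

theorem mul_diagonalProjection_eq_zero (h : IsDiagonalBasis π b χ)
    {T : HilbertTensor H H →L[ℂ] HilbertTensor H H}
    (hT : ∀ i, T (htmul (b i) (b i)) = 0) : T * diagonalProjection π = 0 := by
  refine h.isAtomicDecomposition.mul_diagonalProjection_eq_zero ?_
  rintro i ⟨x, hx⟩
  obtain ⟨c, rfl⟩ := Submodule.mem_span_singleton.1 hx
  change T (htmul (c • b i) (c • b i)) = 0
  rw [smul_htmul, htmul_smul, smul_smul, map_smul, hT, smul_zero]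

end IsDiagonalBasis

end Diagonal

/-! ### Diagonality of the spatial tensor product -/

section SpatialTensor

variable {A B : Type*} [CStarAlgebra A] [CStarAlgebra B]
  {H K : Type*} [NormedAddCommGroup H] [InnerProductSpace ℂ H] [CompleteSpace H]
  [NormedAddCommGroup K] [InnerProductSpace ℂ K] [CompleteSpace K]
  {π : A →⋆ₐ[ℂ] (H →L[ℂ] H)} {σ : B →⋆ₐ[ℂ] (K →L[ℂ] K)}

theorem opTensor_mem_spatialTensor (a : A) (b : B) :
    opTensor (π a) (σ b) ∈ spatialTensor π σ :=
  StarSubalgebra.le_topologicalClosure _ (StarAlgebra.subset_adjoin ℂ _ ⟨a, b, rfl⟩)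

/-- A closed star subalgebra containing the operators `π a ⊗ σ b` contains the spatial tensor
product. -/
theorem spatialTensor_le
    {S : StarSubalgebra ℂ (HilbertTensor H K →L[ℂ] HilbertTensor H K)}
    (hS : IsClosed (S : Set (HilbertTensor H K →L[ℂ] HilbertTensor H K)))
    (h : ∀ a b, opTensor (π a) (σ b) ∈ S) : spatialTensor π σ ≤ S :=
  StarSubalgebra.topologicalClosure_minimal
    (StarAlgebra.adjoin_le (by rintro _ ⟨a, b, rfl⟩; exact h a b)) hS

/-- A morphism of C⋆-algebras maps the spatial tensor product into a closed star subalgebra as soon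
as it maps the generators there. -/
theorem map_mem_of_mem_spatialTensor {L : Type*} [NormedAddCommGroup L] [InnerProductSpace ℂ L]
    [CompleteSpace L] (F : (HilbertTensor H K →L[ℂ] HilbertTensor H K) →⋆ₐ[ℂ] (L →L[ℂ] L))
    {S : StarSubalgebra ℂ (L →L[ℂ] L)} (hS : IsClosed (S : Set (L →L[ℂ] L)))
    (h : ∀ a b, F (opTensor (π a) (σ b)) ∈ S) {T : HilbertTensor H K →L[ℂ] HilbertTensor H K}
    (hT : T ∈ spatialTensor π σ) : F T ∈ S :=
  spatialTensor_le (S := S.comap F) (hS.preimage (map_continuous F)) h hT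

variable {ι κ : Type*} {b : HilbertBasis ι ℂ H} {c : HilbertBasis κ ℂ K} {χ : ι → A → ℂ}
  {ψ : κ → B → ℂ}

/-- The elements of the spatial tensor product are diagonal in a tensor product of bases in which
both representations are diagonal. -/
theorem IsDiagonalBasis.apply_htmul_of_mem_spatialTensor (hb : IsDiagonalBasis π b χ)
    (hc : IsDiagonalBasis σ c ψ) {T : HilbertTensor H K →L[ℂ] HilbertTensor H K}
    (hT : T ∈ spatialTensor π σ) (i : ι) (j : κ) :
    T (htmul (b i) (c j)) =
      inner ℂ (htmul (b i) (c j)) (T (htmul (b i) (c j))) • htmul (b i) (c j) := by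
  set w := htmul (b i) (c j) with hw
  -- The operators commuting with the projection onto the line of `w` form a closed star algebra, so
  -- only generators need checking; commuting with it makes `w` an eigenvector.
  have hle : spatialTensor π σ ≤ StarSubalgebra.centralizer ℂ {rankOne ℂ w w} := by
    refine spatialTensor_le ?_ fun a a' => ?_
    · rw [StarSubalgebra.coe_centralizer]
      exact Set.isClosed_centralizer _
    · have hgen : ∀ a a', opTensor (π a) (σ a') w = (χ i a * ψ j a') • w := fun a a' => by
        rw [hw, opTensor_htmul, hb.apply_basis, hc.apply_basis, smul_htmul, htmul_smul, smul_smul]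
      have hcomm : Commute (opTensor (π a) (σ a')) (rankOne ℂ w w) :=
        commute_rankOne (hgen a a') (by rw [star_opTensor, ← map_star, ← map_star, hgen])
      have hsa : star (rankOne ℂ w w) = rankOne ℂ w w := by
        rw [ContinuousLinearMap.star_eq_adjoint, InnerProductSpace.adjoint_rankOne]
      rw [StarSubalgebra.mem_centralizer_iff]
      rintro _ rfl
      rw [hsa]
      exact ⟨hcomm.eq.symm, hcomm.eq.symm⟩
  have hww : inner ℂ w w = (1 : ℂ) := by
    rw [hw, inner_htmul, inner_self_eq_norm_sq_to_K, inner_self_eq_norm_sq_to_K,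
      b.orthonormal.1 i, c.orthonormal.1 j]
    simp
  have h := DFunLike.congr_fun ((StarSubalgebra.mem_centralizer_iff ℂ).1 (hle hT) _ rfl).1 w
  rw [mul_apply_eq_comp, mul_apply_eq_comp, InnerProductSpace.rankOne_apply,
    InnerProductSpace.rankOne_apply, hww, one_smul] at h
  exact h.symm

/-- A tensor product of bases diagonalising two representations diagonalises the representation of
the spatial tensor product. -/
theorem IsDiagonalBasis.tensor (hb : IsDiagonalBasis π b χ) (hc : IsDiagonalBasis σ c ψ) :
    IsDiagonalBasis (tensorRep π σ) (tensorBasis b c) fun p T =>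
      inner ℂ (tensorBasis b c p) (T.1 (tensorBasis b c p)) := by
  have hval : ∀ p a a', inner ℂ (tensorBasis b c p) (opTensor (π a) (σ a') (tensorBasis b c p)) =
      χ p.1 a * ψ p.2 a' := fun p a a' => by
    rw [tensorBasis_apply, opTensor_htmul, inner_htmul, ← hb.char_eq, ← hc.char_eq]
  have hχ : ∀ i, χ i 1 = 1 := fun i => map_one (hb.char i)
  have hψ : ∀ j, ψ j 1 = 1 := fun j => map_one (hc.char j)
  refine ⟨fun p q hpq => ?_, fun p T => ?_⟩
  · have h := fun a a' => congrFun hpq ⟨_, opTensor_mem_spatialTensor (π := π) (σ := σ) a a'⟩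
    simp only [hval] at h
    refine Prod.ext (hb.injective (funext fun a => ?_)) (hc.injective (funext fun a' => ?_))
    · simpa [hψ] using h a 1
    · simpa [hχ] using h 1 a'
  · change T.1 (tensorBasis b c p) = _
    rw [tensorBasis_apply]
    exact hb.apply_htmul_of_mem_spatialTensor hc T.2 p.1 p.2

end SpatialTensor

/-! ### Quantum metrics as classical metrics on the index set -/

section ClassicalMetric

theorem inner_basis_self {H : Type*} [NormedAddCommGroup H] [InnerProductSpace ℂ H] {ι : Type*}
    (b : HilbertBasis ι ℂ H) (i : ι) : inner ℂ (b i) (b i) = (1 : ℂ) := by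
  rw [inner_self_eq_norm_sq_to_K, b.orthonormal.1 i]
  simp

/-- `d` is a real valued metric on `ι`, which is the diagonal of the operator `ρ` in the basis
`b i ⊗ b j`. -/
structure IsMetricOf {H : Type*} [NormedAddCommGroup H] [InnerProductSpace ℂ H] {ι : Type*}
    (b : HilbertBasis ι ℂ H) (ρ : HilbertTensor H H →L[ℂ] HilbertTensor H H) (d : ι → ι → ℝ) :
    Prop where
  apply_basis : ∀ i j, ρ (htmul (b i) (b j)) = (d i j : ℂ) • htmul (b i) (b j)
  nonneg : ∀ i j, 0 ≤ d i j
  self : ∀ i, d i i = 0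
  eq_of_eq_zero : ∀ i j, d i j = 0 → i = j
  symm : ∀ i j, d i j = d j i
  triangle : ∀ i j k, d i k ≤ d i j + d j k

variable {A : Type*} [CStarAlgebra A]
  {H : Type*} [NormedAddCommGroup H] [InnerProductSpace ℂ H] [CompleteSpace H]
  {π : A →⋆ₐ[ℂ] (H →L[ℂ] H)} {ρ : HilbertTensor H H →L[ℂ] HilbertTensor H H}
  {ι : Type*} {b : HilbertBasis ι ℂ H} {χ : ι → A → ℂ}

/-- Each metric axiom is the corresponding axiom on `ρ` tested on basis tensors; definiteness holds
because `b i ⊗ b j` with `i ≠ j` is orthogonal to the diagonal subspace. -/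
theorem IsCompactQuantumMetricSpace.isMetricOf (h : IsCompactQuantumMetricSpace π ρ)
    (hb : IsDiagonalBasis π b χ) :
    IsMetricOf b ρ fun i j => (inner ℂ (htmul (b i) (b j)) (ρ (htmul (b i) (b j)))).re := by
  classical
  set d : ι → ι → ℝ := fun i j => (inner ℂ (htmul (b i) (b j)) (ρ (htmul (b i) (b j)))).re with hd
  have hpos := (ContinuousLinearMap.nonneg_iff_isPositive ρ).1 h.nonneg
  have hin : ∀ i j, inner ℂ (htmul (b i) (b j)) (ρ (htmul (b i) (b j))) = (d i j : ℂ) :=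
    fun i j => (Complex.conj_eq_iff_re.1 (by
      rw [inner_conj_symm, h.inner_left_eq_inner_right])).symm
  have happ : ∀ i j, ρ (htmul (b i) (b j)) = (d i j : ℂ) • htmul (b i) (b j) := fun i j => by
    rw [← hin]
    exact hb.apply_htmul_of_mem_spatialTensor hb h.mem i j
  have hself : ∀ i, d i i = 0 := fun i => by
    simp only [hd]
    rw [h.apply_of_mem_diagonalSubspace (hb.htmul_mem_diagonalSubspace i), inner_zero_right,
      Complex.zero_re]
  refine ⟨happ, fun i j => hpos.re_inner_nonneg_right _, hself, fun i j hij => ?_, fun i j => ?_,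
    fun i j k => ?_⟩
  · by_contra hne
    have hz : htmul (b i) (b j) = 0 := by
      refine h.eq_zero_of_apply_eq_zero _ (hb.mem_diagonalSubspace_orthogonal fun k => ?_) ?_
      · rw [inner_htmul]
        by_cases hk : k = i
        · rw [b.orthonormal.2 (hk.trans_ne hne), mul_zero]
        · rw [b.orthonormal.2 hk, zero_mul]
      · rw [happ, hij, Complex.ofReal_zero, zero_smul]
    have hn := norm_htmul (b i) (b j)
    rw [hz, b.orthonormal.1 i, b.orthonormal.1 j, norm_zero] at hn
    norm_num at hn
  · have hf := DFunLike.congr_fun h.flip_eq (htmul (b i) (b j))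
    rw [flip_htmul, happ, happ, map_smul, hcomm_htmul] at hf
    have := congrArg (inner ℂ (htmul (b i) (b j))) hf
    simp only [inner_smul_right, inner_htmul, inner_basis_self, mul_one] at this
    exact_mod_cast this.symm
  · have ht := ((ContinuousLinearMap.le_def _ _).1 h.triangle).re_inner_nonneg_right
      (htmul (htmul (b i) (b j)) (b k))
    rw [sub_apply, add_apply, inner_sub_right, inner_add_right, inner_oneTensor, inner_midOne,
      tensorOne_htmul, inner_htmul, hin, hin, hin, inner_basis_self, inner_basis_self,
      inner_basis_self] at ht
    simpa [sub_nonneg] using ht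

/-- All operators involved act explicitly on product basis vectors: positivity and the triangle
inequality become signs of eigenvalues, and the kernel is found coefficient by coefficient. -/
theorem IsMetricOf.isCompactQuantumMetricSpace.{u, v} {A : Type v} [CStarAlgebra A] {H : Type u}
    [NormedAddCommGroup H] [InnerProductSpace ℂ H] [CompleteSpace H]
    {π : A →⋆ₐ[ℂ] (H →L[ℂ] H)} {ρ : HilbertTensor H H →L[ℂ] HilbertTensor H H}
    {ι : Type u} {b : HilbertBasis ι ℂ H} {χ : ι → A → ℂ} {d : ι → ι → ℝ}
    (hd : IsMetricOf b ρ d) (hb : IsDiagonalBasis π b χ) (hinj : Function.Injective π)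
    (hmem : ρ ∈ spatialTensor π π) : IsCompactQuantumMetricSpace π ρ := by
  classical
  have hnonneg : 0 ≤ ρ := by
    refine nonneg_of_hilbertBasis (tensorBasis b b) (d := fun p => d p.1 p.2)
      (fun p => hd.nonneg _ _) fun p => ?_
    rw [tensorBasis_apply, hd.apply_basis]
  have hmul : ρ * diagonalProjection π = 0 :=
    hb.mul_diagonalProjection_eq_zero fun i => by
      rw [hd.apply_basis, hd.self, Complex.ofReal_zero, zero_smul]
  have hsymm : ∀ x y, inner ℂ (ρ x) y = inner ℂ x (ρ y) :=
    ((ContinuousLinearMap.nonneg_iff_isPositive ρ).1 hnonneg).inner_left_eq_inner_right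
  refine ⟨hinj, hb.isAtomicDecomposition.isAtomicRep, hmem, hnonneg, hmul, ?_, fun x hx hρ => ?_,
    ?_, ?_⟩
  · have h := congrArg star hmul
    rwa [star_mul, star_zero, (IsSelfAdjoint.of_nonneg hnonneg).star_eq, diagonalProjection,
      (isSelfAdjoint_starProjection _).star_eq] at h
  · refine inner_eq_zero_of_hilbertBasis (tensorBasis b b) fun p => ?_
    rw [tensorBasis_apply]
    -- Diagonal coefficients of `x` vanish by orthogonality, the others because `d` is nonzero
    -- there.
    by_cases hp : p.1 = p.2
    · rw [← hp]
      exact (Submodule.mem_orthogonal _ _).1 hx _ (hb.htmul_mem_diagonalSubspace _)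
    · have h := hsymm (htmul (b p.1) (b p.2)) x
      rw [hρ, inner_zero_right, hd.apply_basis, inner_smul_left, Complex.conj_ofReal] at h
      refine (mul_eq_zero.1 h).resolve_left fun h0 => hp (hd.eq_of_eq_zero _ _ ?_)
      exact_mod_cast h0
  · refine ext_hilbertBasis (tensorBasis b b) fun p => ?_
    rw [tensorBasis_apply, flip_htmul, hd.apply_basis, hd.apply_basis, map_smul, hcomm_htmul,
      hd.symm]
  · rw [← sub_nonneg]
    refine nonneg_of_hilbertBasis (tensorBasis (tensorBasis b b) b)
      (d := fun p => d p.1.1 p.1.2 + d p.1.2 p.2 - d p.1.1 p.2)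
      (fun p => sub_nonneg.2 (hd.triangle _ _ _)) fun p => ?_
    rw [tensorBasis_apply, tensorBasis_apply, sub_apply, add_apply, tensorOne_htmul,
      oneTensor_htmul, midOne_htmul, hd.apply_basis, hd.apply_basis, hd.apply_basis, smul_htmul,
      htmul_smul, smul_htmul, map_smul, map_smul, hassoc_symm_htmul, hrightComm_htmul,
      ← add_smul, ← sub_smul]
    push_cast
    rfl

end ClassicalMetric

/-! ### The sum metric on the product -/

section SumMetric

theorem hinterchange_symm_htmul {H K L M : Type*}
    [NormedAddCommGroup H] [InnerProductSpace ℂ H] [NormedAddCommGroup K] [InnerProductSpace ℂ K]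
    [NormedAddCommGroup L] [InnerProductSpace ℂ L] [NormedAddCommGroup M] [InnerProductSpace ℂ M]
    (x : H) (y : K) (z : L) (w : M) :
    (hinterchange H L K M).symm (htmul (htmul x y) (htmul z w)) =
      htmul (htmul x z) (htmul y w) := by
  rw [LinearIsometryEquiv.symm_apply_eq, hinterchange_htmul]

variable {A₁ A₂ H₁ H₂ : Type*} [CStarAlgebra A₁] [CStarAlgebra A₂]
  [NormedAddCommGroup H₁] [InnerProductSpace ℂ H₁] [CompleteSpace H₁]
  [NormedAddCommGroup H₂] [InnerProductSpace ℂ H₂] [CompleteSpace H₂]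
  {π₁ : A₁ →⋆ₐ[ℂ] (H₁ →L[ℂ] H₁)} {π₂ : A₂ →⋆ₐ[ℂ] (H₂ →L[ℂ] H₂)}
  {ρ₁ : HilbertTensor H₁ H₁ →L[ℂ] HilbertTensor H₁ H₁}
  {ρ₂ : HilbertTensor H₂ H₂ →L[ℂ] HilbertTensor H₂ H₂}
  {ι κ : Type*} {b : HilbertBasis ι ℂ H₁} {c : HilbertBasis κ ℂ H₂}

theorem conj_hinterchange_opTensor (S T : H₁ →L[ℂ] H₁) (S' T' : H₂ →L[ℂ] H₂) :
    (hinterchange H₁ H₁ H₂ H₂).conjStarAlgEquiv (opTensor (opTensor S T) (opTensor S' T')) =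
      opTensor (opTensor S S') (opTensor T T') := by
  obtain ⟨s, b, -⟩ := exists_hilbertBasis ℂ H₁
  obtain ⟨t, c, -⟩ := exists_hilbertBasis ℂ H₂
  refine ext_hilbertBasis (tensorBasis (tensorBasis b c) (tensorBasis b c)) fun p => ?_
  simp [tensorBasis_apply, LinearIsometryEquiv.conjStarAlgEquiv_apply, hinterchange_symm_htmul,
    opTensor_htmul, hinterchange_htmul]

/-- Both amplifications, followed by the reordering, are star morphisms, so it is enough to place
the images of generators, such as `(a ⊗ 1) ⊗ (a' ⊗ 1)`. -/
theorem sumMetric_mem_spatialTensor (h₁ : ρ₁ ∈ spatialTensor π₁ π₁)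
    (h₂ : ρ₂ ∈ spatialTensor π₂ π₂) :
    sumMetric ρ₁ ρ₂ ∈ spatialTensor (tensorRep π₁ π₂) (tensorRep π₁ π₂) := by
  have hgen : ∀ (a a' : A₁) (b b' : A₂), opTensor (opTensor (π₁ a) (π₂ b))
      (opTensor (π₁ a') (π₂ b')) ∈ spatialTensor (tensorRep π₁ π₂) (tensorRep π₁ π₂) :=
    fun a a' b b' => opTensor_mem_spatialTensor (π := tensorRep π₁ π₂) (σ := tensorRep π₁ π₂)
      ⟨_, opTensor_mem_spatialTensor a b⟩ ⟨_, opTensor_mem_spatialTensor a' b'⟩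
  let Φ := (hinterchange H₁ H₁ H₂ H₂).conjStarAlgEquiv.toStarAlgHom
  have e₁ : Φ (opTensor ρ₁ 1) ∈ spatialTensor (tensorRep π₁ π₂) (tensorRep π₁ π₂) := by
    refine map_mem_of_mem_spatialTensor (Φ.comp (amplifyLeft _ _))
      (StarSubalgebra.isClosed_topologicalClosure _) (fun a a' => ?_) h₁
    change (hinterchange H₁ H₁ H₂ H₂).conjStarAlgEquiv (opTensor (opTensor (π₁ a) (π₁ a')) 1) ∈ _
    rw [← opTensor_one, conj_hinterchange_opTensor, ← map_one π₂]
    exact hgen a a' 1 1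
  have e₂ : Φ (opTensor 1 ρ₂) ∈ spatialTensor (tensorRep π₁ π₂) (tensorRep π₁ π₂) := by
    refine map_mem_of_mem_spatialTensor (Φ.comp (amplifyRight _ _))
      (StarSubalgebra.isClosed_topologicalClosure _) (fun a a' => ?_) h₂
    change (hinterchange H₁ H₁ H₂ H₂).conjStarAlgEquiv (opTensor 1 (opTensor (π₂ a) (π₂ a'))) ∈ _
    rw [← opTensor_one, conj_hinterchange_opTensor, ← map_one π₁]
    exact hgen 1 1 a a'
  have hsum : sumMetric ρ₁ ρ₂ = Φ (opTensor ρ₁ 1) + Φ (opTensor 1 ρ₂) := map_add Φ _ _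
  rw [hsum]
  exact add_mem e₁ e₂

theorem sumMetric_htmul (x z : H₁) (y w : H₂) {d e : ℂ}
    (hd : ρ₁ (htmul x z) = d • htmul x z) (he : ρ₂ (htmul y w) = e • htmul y w) :
    sumMetric ρ₁ ρ₂ (htmul (htmul x y) (htmul z w)) =
      (d + e) • htmul (htmul x y) (htmul z w) := by
  simp [sumMetric, LinearIsometryEquiv.conjStarAlgEquiv_apply, hinterchange_symm_htmul,
    opTensor_htmul, hd, he, smul_htmul, htmul_smul, hinterchange_htmul, add_smul]

/-- The diagonal of the sum of two quantum metrics is the sum of the metrics on the product. -/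
theorem IsMetricOf.sumMetric {d : ι → ι → ℝ} {e : κ → κ → ℝ} (hd : IsMetricOf b ρ₁ d)
    (he : IsMetricOf c ρ₂ e) :
    IsMetricOf (tensorBasis b c) (sumMetric ρ₁ ρ₂) fun p q => d p.1 q.1 + e p.2 q.2 where
  apply_basis p q := by
    rw [tensorBasis_apply, tensorBasis_apply,
      sumMetric_htmul _ _ _ _ (hd.apply_basis _ _) (he.apply_basis _ _)]
    push_cast
    rfl
  nonneg p q := add_nonneg (hd.nonneg _ _) (he.nonneg _ _)
  self p := by rw [hd.self, he.self, add_zero]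
  eq_of_eq_zero p q h := by
    rw [add_eq_zero_iff_of_nonneg (hd.nonneg _ _) (he.nonneg _ _)] at h
    exact Prod.ext (hd.eq_of_eq_zero _ _ h.1) (he.eq_of_eq_zero _ _ h.2)
  symm p q := by rw [hd.symm, he.symm]
  triangle p q r := by
    have h1 := hd.triangle p.1 q.1 r.1
    have h2 := he.triangle p.2 q.2 r.2
    linarith

end SumMetric

end QuantumMetric

end

theorem theorem4 {A₁ A₂ H₁ H₂ : Type*} [CStarAlgebra A₁] [CStarAlgebra A₂]
    [NormedAddCommGroup H₁] [InnerProductSpace ℂ H₁] [CompleteSpace H₁]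
    [NormedAddCommGroup H₂] [InnerProductSpace ℂ H₂] [CompleteSpace H₂]
    (π₁ : A₁ →⋆ₐ[ℂ] (H₁ →L[ℂ] H₁)) (π₂ : A₂ →⋆ₐ[ℂ] (H₂ →L[ℂ] H₂))
    (ρ₁ : QuantumMetric.HilbertTensor H₁ H₁ →L[ℂ] QuantumMetric.HilbertTensor H₁ H₁)
    (ρ₂ : QuantumMetric.HilbertTensor H₂ H₂ →L[ℂ] QuantumMetric.HilbertTensor H₂ H₂)
    (h₁ : QuantumMetric.IsCompactQuantumMetricSpace π₁ ρ₁)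
    (h₂ : QuantumMetric.IsCompactQuantumMetricSpace π₂ ρ₂) :
    QuantumMetric.IsCompactQuantumMetricSpace (QuantumMetric.tensorRep π₁ π₂)
      (QuantumMetric.sumMetric ρ₁ ρ₂) := by
  obtain ⟨ι, b, χ, hb⟩ := h₁.exists_isDiagonalBasis
  obtain ⟨κ, c, ψ, hc⟩ := h₂.exists_isDiagonalBasis
  exact ((h₁.isMetricOf hb).sumMetric (h₂.isMetricOf hc)).isCompactQuantumMetricSpace
    (hb.tensor hc) Subtype.val_injective
    (QuantumMetric.sumMetric_mem_spatialTensor h₁.mem h₂.mem)
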